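/- Let $(W,R)$ be a Coxeter system of type $H_3$, with set of reflections $T=\bigcup_{w\in W} w^{-1}Rw$. For $w\in W$ let $\ell_T(w)$ be the least $k$ such that $w$ is a product of $k$ elements of $T$; write $x\preceq w$ if $\ell_T(w)=\ell_T(x)+\ell_T(x^{-1}w)$, and $[1,w]=\{x\in W : x\preceq w\}$. The interval group $G([1,w])$ is the group presented by generators $\boldsymbol{x}$, one for each $x\in[1,w]$, and relations $\boldsymbol{u}\boldsymbol{v}=\boldsymbol{r}$ for all $u,v,r\in[1,w]$ with $uv=r$ and $u\preceq r$. A quasi-Coxeter element is an element $w$ having a decomposition $w=t_1\cdots t_k$ with $t_i\in T$, $k=\ell_T(w)$ and $\langle t_1,\dots,t_k\rangle=W$; it is proper if it is not conjugate to a product of all the elements of $R$ in some order. The proper quasi-Coxeter elements of order $10$ of $W$ form one conjugacy class, denoted $H_3(a_1)$. For every $w$ in this class, the interval group $G([1,w])$ is isomorphic to the Artin group of type $H_3$, the poset $([1,w],\preceq)$ is a lattice, and $G([1,w])$ is a Garside group, that is, the group of left fractions $a^{-1}b$ of some Garside monoid. Here a Garside monoid is a cancellative monoid $M$ with an element $\Delta$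 such that: there is a map $\lambda: M\to\mathbb{Z}_{\ge 0}$ with $\lambda(ab)\ge\lambda(a)+\lambda(b)$ for all $a,b$ and $\lambda(a)\ne 0$ for $a\neq 1$; any two elements have a least common multiple and a greatest common divisor with respect to left divisibility, and likewise with respect to right divisibility; and the left divisors of $\Delta$ coincide with its right divisors, are finite in number and generate $M$. -/

import Mathlib

universe u

namespace DualCoxeter

/-! ### Reflection length, absolute order and intervals in a Coxeter group -/

section Interval

variable {B W : Type*} [Group W] {M : CoxeterMatrix B} (cs : CoxeterSystem M W)

/-- `l` is a decomposition of `w` as a product of reflections. -/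
def IsReflectionWord (l : List W) (w : W) : Prop :=
  (∀ t ∈ l, cs.IsReflection t) ∧ l.prod = w

/-- The reflection length `ℓ_T(w)`: the least length of a decomposition of `w` as a product of
reflections. Such decompositions exist, since the simple reflections generate `W`. -/
noncomputable def reflectionLength (w : W) : ℕ :=
  sInf {k | ∃ l : List W, IsReflectionWord cs l w ∧ l.length = k}

/-- The absolute order `x ≼ w` (left division): `ℓ_T(w) = ℓ_T(x) + ℓ_T(x⁻¹ w)`. -/
def AbsLE (x w : W) : Prop :=
  reflectionLength cs w = reflectionLength cs x + reflectionLength cs (x⁻¹ * w)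

/-- The interval `[1, w]` of the left divisors of `w` for the absolute order. -/
def Interval (w : W) : Type _ := {x : W // AbsLE cs x w}

/-- The poset `([1, w], ≼)` is a lattice. -/
def IntervalIsLattice (w : W) : Prop :=
  ∃ L : Lattice (Interval cs w), ∀ x y : Interval cs w, L.le x y ↔ AbsLE cs x.1 y.1

/-- The relators `[u] [v] [r]⁻¹`, for `u, v, r ∈ [1, w]` with `u v = r` and `u ≼ r`. -/
def intervalRelators (w : W) : Set (FreeGroup (Interval cs w)) :=
  {g | ∃ u v r : Interval cs w, u.1 * v.1 = r.1 ∧ AbsLE cs u.1 r.1 ∧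
    g = FreeGroup.of u * FreeGroup.of v * (FreeGroup.of r)⁻¹}

/-- The interval group `G([1, w])`, given by its presentation on a copy of `[1, w]`. -/
abbrev IntervalGroup (w : W) : Type _ := PresentedGroup (intervalRelators cs w)

/-- A Coxeter element: a conjugate of the product, in some order, of all simple reflections. -/
def IsCoxeterElement (w : W) : Prop :=
  ∃ l : List B, l.Nodup ∧ (∀ i, i ∈ l) ∧ IsConj (cs.wordProd l) w

/-- A quasi-Coxeter element: some reduced decomposition into reflections generates `W`. -/
def IsQuasiCoxeterElement (w : W) : Prop :=
  ∃ l : List W, IsReflectionWord cs l w ∧ l.length = reflectionLength cs w ∧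
    Subgroup.closure {t | t ∈ l} = ⊤

/-- A proper quasi-Coxeter element: a quasi-Coxeter element that is not a Coxeter element. -/
def IsProperQuasiCoxeterElement (w : W) : Prop :=
  IsQuasiCoxeterElement cs w ∧ ¬ IsCoxeterElement cs w

end Interval

/-- The elements of the class `H₃(a₁)`: the proper quasi-Coxeter elements of order `10`. (The
other class `H₃(a₂)` of proper quasi-Coxeter elements consists of elements of order `6`.) -/
def IsTypeH3a1 {W : Type*} [Group W] (cs : CoxeterSystem CoxeterMatrix.H₃ W) (w : W) : Prop :=
  IsProperQuasiCoxeterElement cs w ∧ orderOf w = 10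

/-! ### Artin groups -/

/-- The alternating product `a b a b ⋯` with `m` factors. -/
def altProd {G : Type*} [Group G] (a b : G) : ℕ → G
  | 0 => 1
  | m + 1 => a * altProd b a m

/-- The braid relators `(a b a ⋯) (b a b ⋯)⁻¹`, with `m_{ab}` factors on either side. For
`m_{ab} = 0` (the encoding of `∞`) and for equal generators the relator is trivial. -/
def artinRelators {B : Type*} (M : CoxeterMatrix B) : Set (FreeGroup B) :=
  {g | ∃ i j : B, g = altProd (FreeGroup.of i) (FreeGroup.of j) (M i j) *
    (altProd (FreeGroup.of j) (FreeGroup.of i) (M i j))⁻¹}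

/-- The Artin group of a Coxeter matrix. -/
abbrev ArtinGroup {B : Type*} (M : CoxeterMatrix B) : Type _ := PresentedGroup (artinRelators M)

/-! ### Garside monoids and Garside groups -/

section Garside

variable {M : Type*} [Monoid M]

/-- `a` is a left divisor of `b`. -/
def LeftDvd (a b : M) : Prop := ∃ c, b = a * c

/-- `a` is a right divisor of `b`. -/
def RightDvd (a b : M) : Prop := ∃ c, b = c * a

/-- With respect to the divisibility relation `r`, any two elements have a least common multiple
and a greatest common divisor. -/
def HasLcmGcd (r : M → M → Prop) : Prop :=
  ∀ a b : M,
    (∃ m, r a m ∧ r b m ∧ ∀ x, r a x → r b x → r m x) ∧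
    (∃ d, r d a ∧ r d b ∧ ∀ x, r x a → r x b → r x d)

/-- `(M, Δ)` is a Garside monoid: `M` is cancellative, has a superadditive length function to `ℕ`
that vanishes only at `1`, has lcms and gcds for left and for right divisibility, and the
left divisors and the right divisors of `Δ` coincide, generate `M` and are finite in number. -/
structure IsGarsideMonoid (M : Type*) [Monoid M] (Δ : M) : Prop where
  cancel : IsCancelMul M
  length : ∃ lam : M → ℕ, (∀ a b, lam a + lam b ≤ lam (a * b)) ∧ ∀ a, a ≠ 1 → lam a ≠ 0
  left_lcm_gcd : HasLcmGcd (LeftDvd : M → M → Prop)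
  right_lcm_gcd : HasLcmGcd (RightDvd : M → M → Prop)
  balanced : ∀ a : M, LeftDvd a Δ ↔ RightDvd a Δ
  generate : Submonoid.closure {a : M | LeftDvd a Δ} = ⊤
  finite : {a : M | LeftDvd a Δ}.Finite

/-- `G` is a Garside group: it is the group of fractions of a Garside monoid, that is, some Garside
monoid `M` embeds in `G` in such a way that every element of `G` is a fraction `a⁻¹ b` with
`a, b ∈ M`. -/
def IsGarsideGroup (G : Type u) [Group G] : Prop :=
  ∃ (M : Type u) (_ : Monoid M) (Δ : M) (ι : M →* G), IsGarsideMonoid M Δ ∧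
    Function.Injective ι ∧ ∀ g : G, ∃ a b : M, g = (ι a)⁻¹ * ι b

end Garside

end DualCoxeter

/-!
# Interval groups of the proper quasi-Coxeter elements of order ten in type `H₃`

Let `w` be a proper quasi-Coxeter element of order `10`. The proof has four ingredients.

*Garside structure.* If an interval `[1, w]` for the absolute order is finite and a lattice, then
its interval group is a Garside group (`isGarsideGroup_of_intervalIsLattice`). The monoid with the
same presentation acts from the right on `[1, w]` by complements `(s, t) ↦ t⁻¹ (s ⊔ t)`, and the
action records the opposite complement `s⁻¹ (s ⊔ t)` in the monoid itself (`complHom`). This shows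
that the monoid is left cancellative and that the join of two generators is their least common
multiple; pasting complement squares yields all least common multiples, and the additive length
function yields greatest common divisors. The generator `[w]` is quasi-central (`delta_mul`),
whence right cancellation, common left multiples, and with them lcms and gcds for right
divisibility. By Ore's theorem the monoid embeds in a group, thus in its group of fractions, the
interval group.

*Rank three.* Here `ℓ_T(w) = 3`, and every reflection lies below `w`. The interval is a lattice as
soon as two distinct reflections have at most one common upper bound of length two below `w`
(`exists_meet_of_length_eq_three`, `intervalIsLattice_of_exists_meet`). A map `τ` from the
reflections to a group extends to the interval group if `τ t * τ u * τ v` takes the same value on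
all factorizations `w = t u v` into reflections (`exists_intervalGroup_hom`).

*Comparison with the Artin group.* There is a factorization `w = a c b` into reflections that
satisfy the braid relations of type `H₃`, and the conjugates of `a`, `b`, `c` by powers of `w` are
the `15` reflections, five in each orbit. In any group, three elements with these braid relations
have a Coxeter element `a c b` whose fifth power commutes with them (`commute_pow_five`), so that
the corresponding `15` conjugates are defined in the Artin group as well, and up to conjugation by
`w` the factorizations of `w` are ten explicit ones that are consequences of the braid relations
(`dualGen_mul_of_mem`). This gives a homomorphism from the interval group to the Artin group; the
inverse exists because the braid relations between `a`, `b`, `c` follow from relations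
`[t] [u] = [u] [u⁻¹ t u]` of the interval group (`isH3Triple_gen`).

*Finite verifications.* Coset enumeration over the dihedral parabolic subgroup shows that the
Coxeter group of type `H₃` consists of at most `120` explicit words (`exists_h3Word`). They act
differently in a permutation representation of degree `7`, which is hence faithful; permutations
being encoded by numerals, the remaining facts are verified by evaluation on the list of all
elements (`exists_isH3Coding`). In particular the elements of order `10` form two conjugacy
classes, that of the Coxeter elements and that of `w`.
-/

namespace DualCoxeter

/-! ### Reflection length and the absolute order -/

section AbsoluteOrder

variable {B W : Type*} [Group W] {M : CoxeterMatrix B} (cs : CoxeterSystem M W)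

theorem IsReflectionWord.append {l l' : List W} {x y : W} (h : IsReflectionWord cs l x)
    (h' : IsReflectionWord cs l' y) : IsReflectionWord cs (l ++ l') (x * y) := by
  refine ⟨fun t ht => ?_, by rw [List.prod_append, h.2, h'.2]⟩
  rcases List.mem_append.1 ht with ht | ht
  exacts [h.1 t ht, h'.1 t ht]

theorem IsReflectionWord.conj {l : List W} {x : W} (h : IsReflectionWord cs l x) (g : W) :
    IsReflectionWord cs (l.map (MulAut.conj g)) (g * x * g⁻¹) := by
  refine ⟨fun t ht => ?_, ?_⟩
  · obtain ⟨u, hu, rfl⟩ := List.mem_map.1 ht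
    exact (h.1 u hu).conj g
  · rw [← map_list_prod, h.2, MulAut.conj_apply]

theorem exists_isReflectionWord (w : W) : ∃ l, IsReflectionWord cs l w := by
  induction w using cs.simple_induction with
  | simple i => exact ⟨[cs.simple i], by simp [cs.isReflection_simple], by simp⟩
  | one => exact ⟨[], by simp, by simp⟩
  | mul x y hx hy =>
    obtain ⟨l, hl⟩ := hx
    obtain ⟨l', hl'⟩ := hy
    exact ⟨_, hl.append cs hl'⟩

theorem reflectionLength_le {l : List W} {w : W} (h : IsReflectionWord cs l w) :
    reflectionLength cs w ≤ l.length :=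
  Nat.sInf_le ⟨l, h, rfl⟩

theorem exists_reduced_isReflectionWord (w : W) :
    ∃ l, IsReflectionWord cs l w ∧ l.length = reflectionLength cs w := by
  obtain ⟨l, hl⟩ := exists_isReflectionWord cs w
  exact Nat.sInf_mem (s := {k | ∃ l : List W, IsReflectionWord cs l w ∧ l.length = k})
    ⟨_, l, hl, rfl⟩

@[simp]
theorem reflectionLength_one : reflectionLength cs 1 = 0 := by
  simpa using reflectionLength_le cs (l := []) (w := 1) ⟨by simp, by simp⟩

theorem reflectionLength_eq_zero {w : W} : reflectionLength cs w = 0 ↔ w = 1 := by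
  refine ⟨fun h => ?_, fun h => by rw [h, reflectionLength_one]⟩
  obtain ⟨l, hl, hlen⟩ := exists_reduced_isReflectionWord cs w
  rw [h, List.length_eq_zero_iff] at hlen
  rw [← hl.2, hlen, List.prod_nil]

theorem reflectionLength_mul_le (x y : W) :
    reflectionLength cs (x * y) ≤ reflectionLength cs x + reflectionLength cs y := by
  obtain ⟨l, hl, h⟩ := exists_reduced_isReflectionWord cs x
  obtain ⟨l', hl', h'⟩ := exists_reduced_isReflectionWord cs y
  simpa [h, h'] using reflectionLength_le cs (hl.append cs hl')

theorem reflectionLength_conj (g x : W) :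
    reflectionLength cs (g * x * g⁻¹) = reflectionLength cs x := by
  have key (g x : W) : reflectionLength cs (g * x * g⁻¹) ≤ reflectionLength cs x := by
    obtain ⟨l, hl, h⟩ := exists_reduced_isReflectionWord cs x
    simpa [h] using reflectionLength_le cs (hl.conj cs g)
  refine le_antisymm (key g x) ?_
  simpa [mul_assoc] using key g⁻¹ (g * x * g⁻¹)

theorem reflectionLength_le_one {t : W} (ht : cs.IsReflection t) : reflectionLength cs t ≤ 1 :=
  reflectionLength_le cs (l := [t]) ⟨by simpa using ht, by simp⟩

theorem isReflection_of_reflectionLength_eq_one {t : W} (h : reflectionLength cs t = 1) :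
    cs.IsReflection t := by
  obtain ⟨l, hl, hlen⟩ := exists_reduced_isReflectionWord cs t
  rw [h] at hlen
  obtain ⟨u, rfl⟩ := List.length_eq_one_iff.1 hlen
  have := hl.2
  simp only [List.prod_cons, List.prod_nil, mul_one] at this
  exact this ▸ hl.1 u (by simp)

theorem not_isReflection_one : ¬ cs.IsReflection (1 : W) := fun h => by
  simpa using h.odd_length

theorem reflectionLength_eq_one {t : W} : reflectionLength cs t = 1 ↔ cs.IsReflection t := by
  refine ⟨isReflection_of_reflectionLength_eq_one cs, fun h => ?_⟩
  refine le_antisymm (reflectionLength_le_one cs h) (Nat.one_le_iff_ne_zero.2 fun h0 => ?_)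
  rw [reflectionLength_eq_zero] at h0
  exact not_isReflection_one cs (h0 ▸ h)

theorem absLE_mul_iff {x y : W} : AbsLE cs x (x * y) ↔
    reflectionLength cs (x * y) = reflectionLength cs x + reflectionLength cs y := by
  rw [AbsLE, inv_mul_cancel_left]

theorem absLE_one_left (w : W) : AbsLE cs 1 w := by simp [AbsLE]

@[simp]
theorem absLE_refl (w : W) : AbsLE cs w w := by simp [AbsLE]

theorem AbsLE.antisymm {x y : W} (h : AbsLE cs x y) (h' : AbsLE cs y x) : x = y := by
  rw [AbsLE] at h h'
  have h0 : reflectionLength cs (x⁻¹ * y) = 0 := by omega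
  rw [reflectionLength_eq_zero, inv_mul_eq_one] at h0
  exact h0

theorem AbsLE.trans {x y z : W} (h : AbsLE cs x y) (h' : AbsLE cs y z) : AbsLE cs x z := by
  unfold AbsLE at *
  have h1 := reflectionLength_mul_le cs x (x⁻¹ * z)
  have h2 := reflectionLength_mul_le cs (x⁻¹ * y) (y⁻¹ * z)
  rw [show x * (x⁻¹ * z) = z by group] at h1
  rw [show x⁻¹ * y * (y⁻¹ * z) = x⁻¹ * z by group] at h2
  omega

/-- The absolute order is symmetric: left and right divisors agree, since the reflection length is
invariant under conjugation. -/
theorem absLE_mul_right_iff {x y : W} : AbsLE cs y (x * y) ↔ AbsLE cs x (x * y) := by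
  rw [absLE_mul_iff, AbsLE, show y⁻¹ * (x * y) = y⁻¹ * x * y⁻¹⁻¹ by group, reflectionLength_conj,
    add_comm]

theorem AbsLE.conj {x y : W} (h : AbsLE cs x y) (g : W) :
    AbsLE cs (g * x * g⁻¹) (g * y * g⁻¹) := by
  rw [AbsLE, show (g * x * g⁻¹)⁻¹ * (g * y * g⁻¹) = g * (x⁻¹ * y) * g⁻¹ by group]
  rwa [reflectionLength_conj, reflectionLength_conj, reflectionLength_conj]

theorem AbsLE.inv_mul {x y : W} (h : AbsLE cs x y) : AbsLE cs (x⁻¹ * y) y := by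
  have : AbsLE cs x (x * (x⁻¹ * y)) := by simpa using h
  simpa using (absLE_mul_right_iff cs).2 this

theorem AbsLE.mul_inv {x y : W} (h : AbsLE cs x y) : AbsLE cs (y * x⁻¹) y := by
  have : AbsLE cs x (y * x⁻¹ * x) := by simpa using h
  simpa using (absLE_mul_right_iff cs).1 this

/-- Left translation by a divisor `t` of `x` preserves the absolute order above `t`. -/
theorem AbsLE.inv_mul_inv_mul_iff {t x y : W} (hx : AbsLE cs t x) (hy : AbsLE cs t y) :
    AbsLE cs (t⁻¹ * x) (t⁻¹ * y) ↔ AbsLE cs x y := by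
  unfold AbsLE at *
  rw [show (t⁻¹ * x)⁻¹ * (t⁻¹ * y) = x⁻¹ * y by group]
  omega

/-- Left translation by `t` maps the divisors of `t⁻¹ * w` into `[1, w]`. -/
theorem AbsLE.of_absLE_inv_mul {t x w : W} (ht : AbsLE cs t w) (hx : AbsLE cs x (t⁻¹ * w)) :
    AbsLE cs t (t * x) ∧ AbsLE cs (t * x) w := by
  unfold AbsLE at *
  have h1 := reflectionLength_mul_le cs t x
  have h2 := reflectionLength_mul_le cs (t * x) ((t * x)⁻¹ * w)
  rw [show t * x * ((t * x)⁻¹ * w) = w by group] at h2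
  rw [show x⁻¹ * (t⁻¹ * w) = (t * x)⁻¹ * w by group] at hx
  rw [show t⁻¹ * (t * x) = x by group]
  omega

theorem AbsLE.inv_mul_absLE_inv_mul {t x w : W} (ht : AbsLE cs t x) (hx : AbsLE cs x w) :
    AbsLE cs (t⁻¹ * x) (t⁻¹ * w) :=
  (AbsLE.inv_mul_inv_mul_iff cs ht (ht.trans cs hx)).2 hx

end AbsoluteOrder

/-! ### Least common multiples and greatest common divisors in cancellative monoids -/

section Monoids

variable {M : Type*} [Monoid M]

theorem LeftDvd.trans {a b c : M} (h : LeftDvd a b) (h' : LeftDvd b c) : LeftDvd a c := by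
  obtain ⟨x, rfl⟩ := h
  obtain ⟨y, rfl⟩ := h'
  exact ⟨x * y, mul_assoc ..⟩

theorem LeftDvd.mul_left {a b : M} (h : LeftDvd a b) (c : M) : LeftDvd (c * a) (c * b) := by
  obtain ⟨x, rfl⟩ := h
  exact ⟨x, (mul_assoc ..).symm⟩

theorem leftDvd_mul_right (a b : M) : LeftDvd a (a * b) := ⟨b, rfl⟩

/-- `m` is a least common multiple of `a` and `b` with respect to left divisibility. -/
def IsLeftLcm (a b m : M) : Prop :=
  LeftDvd a m ∧ LeftDvd b m ∧ ∀ x, LeftDvd a x → LeftDvd b x → LeftDvd m x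

theorem IsLeftLcm.symm {a b m : M} (h : IsLeftLcm a b m) : IsLeftLcm b a m :=
  ⟨h.2.1, h.1, fun x hb ha => h.2.2 x ha hb⟩

/-- Least common multiples are computed by pasting two complement squares side by side. -/
theorem IsLeftLcm.paste [IsLeftCancelMul M] {a b c a' m : M} (h : IsLeftLcm b a (b * a'))
    (h' : IsLeftLcm c a' m) : IsLeftLcm (b * c) a (b * m) := by
  refine ⟨h'.1.mul_left b, h.2.1.trans (h'.2.1.mul_left b), fun x hbc ha => ?_⟩
  obtain ⟨y, rfl⟩ := hbc
  obtain ⟨z, hz⟩ := h.2.2 _ ((leftDvd_mul_right b c).trans (leftDvd_mul_right _ y)) ha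
  rw [mul_assoc, mul_assoc] at hz
  have hz' := mul_left_cancel hz
  rw [mul_assoc]
  exact (h'.2.2 _ (leftDvd_mul_right c y) ⟨z, hz'⟩).mul_left b

/-- If a left cancellative monoid is generated by a set `X` such that any `s, t ∈ X` have a least
common multiple of the form `t * s'` with `s' ∈ X`, then any two elements have a least common
multiple. -/
theorem exists_isLeftLcm_of_closure_eq_top [IsLeftCancelMul M] {X : Set M}
    (hX : Submonoid.closure X = ⊤)
    (h : ∀ s ∈ X, ∀ t ∈ X, ∃ s' ∈ X, IsLeftLcm s t (t * s')) (a b : M) :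
    ∃ m, IsLeftLcm a b m := by
  have one_lcm (a : M) : IsLeftLcm 1 a a :=
    ⟨⟨a, (one_mul a).symm⟩, ⟨1, (mul_one a).symm⟩, fun x _ ha => ha⟩
  have step : ∀ b : M, ∀ s ∈ X, ∃ s' ∈ X, IsLeftLcm s b (b * s') := by
    intro b
    have hb : b ∈ Submonoid.closure X := hX ▸ Submonoid.mem_top b
    induction hb using Submonoid.closure_induction with
    | mem t ht => exact fun s hs => h s hs t ht
    | one => exact fun s hs => ⟨s, hs, by simpa using (one_lcm s).symm⟩
    | mul b c _ _ hb hc =>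
      intro s hs
      obtain ⟨s₁, hs₁, h₁⟩ := hb s hs
      obtain ⟨s₂, hs₂, h₂⟩ := hc s₁ hs₁
      exact ⟨s₂, hs₂, by simpa [mul_assoc] using (h₁.symm.paste h₂.symm).symm⟩
  have ha : a ∈ Submonoid.closure X := hX ▸ Submonoid.mem_top a
  induction ha using Submonoid.closure_induction generalizing b with
  | mem s hs =>
    obtain ⟨s', -, h'⟩ := step b s hs
    exact ⟨_, h'⟩
  | one => exact ⟨b, one_lcm b⟩
  | mul a c _ _ ha hc =>
    obtain ⟨m, hm⟩ := ha b
    obtain ⟨b', rfl⟩ := hm.1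
    obtain ⟨m', hm'⟩ := hc b'
    exact ⟨_, hm.paste hm'⟩

variable {lam : M → ℕ}

/-- In the presence of a length function, greatest common divisors are obtained as common divisors
of maximal length. -/
theorem hasLcmGcd_leftDvd (hadd : ∀ a b, lam a + lam b ≤ lam (a * b))
    (hpos : ∀ a, a ≠ 1 → lam a ≠ 0) (hlcm : ∀ a b : M, ∃ m, IsLeftLcm a b m) :
    HasLcmGcd (LeftDvd : M → M → Prop) := by
  intro a b
  refine ⟨hlcm a b, ?_⟩
  have hle {x y : M} (h : LeftDvd x y) : lam x ≤ lam y := by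
    obtain ⟨z, rfl⟩ := h
    exact (Nat.le_add_right _ _).trans (hadd x z)
  let P : ℕ → Prop := fun n => ∃ d, LeftDvd d a ∧ LeftDvd d b ∧ lam d = n
  have h1 : P (lam 1) := ⟨1, ⟨a, (one_mul a).symm⟩, ⟨b, (one_mul b).symm⟩, rfl⟩
  classical
  have hb : ∀ n, P n → n ≤ lam a := by
    rintro n ⟨d, hda, -, rfl⟩
    exact hle hda
  obtain ⟨d, hda, hdb, hd⟩ := Nat.findGreatest_spec (hb _ h1) h1
  refine ⟨d, hda, hdb, fun x hxa hxb => ?_⟩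
  obtain ⟨m, hdm, hxm, hm⟩ := hlcm d x
  have hmax : lam m ≤ lam d := by
    have hPm : P (lam m) := ⟨m, hm a hda hxa, hm b hdb hxb, rfl⟩
    rw [hd]
    exact Nat.le_findGreatest (hb _ hPm) hPm
  obtain ⟨y, rfl⟩ := hdm
  have hy : y = 1 := by
    by_contra hy
    have := hadd d y
    have := hpos y hy
    omega
  rwa [hy, mul_one] at hxm

/-- In a cancellative monoid with a length function in which common left multiples exist, lcms and
gcds for left divisibility yield lcms and gcds for right divisibility. For the gcd of `a` and `b`,
write a common multiple as `n = a' * a = b' * b`; then `n = m * d`, where `m` is the lcm of `a'`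
and `b'` for left divisibility, and `d` is the gcd. The lcm is a common multiple of least length. -/
theorem hasLcmGcd_rightDvd [IsCancelMul M] (hadd : ∀ a b, lam a + lam b ≤ lam (a * b))
    (hpos : ∀ a, a ≠ 1 → lam a ≠ 0) (hlcm : ∀ a b : M, ∃ m, IsLeftLcm a b m)
    (hcm : ∀ a b : M, ∃ x y, x * a = y * b) :
    HasLcmGcd (RightDvd : M → M → Prop) := by
  have hgcd (a b : M) : ∃ d, RightDvd d a ∧ RightDvd d b ∧
      ∀ x, RightDvd x a → RightDvd x b → RightDvd x d := by
    obtain ⟨a', b', hn⟩ := hcm a b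
    obtain ⟨m, ⟨x, hx⟩, ⟨y, hy⟩, hm⟩ := hlcm a' b'
    obtain ⟨d, hd⟩ := hm (a' * a) ⟨a, rfl⟩ ⟨b, hn⟩
    refine ⟨d, ⟨x, ?_⟩, ⟨y, ?_⟩, ?_⟩
    · rw [hx, mul_assoc] at hd
      exact mul_left_cancel hd
    · rw [hn, hy, mul_assoc] at hd
      exact mul_left_cancel hd
    · rintro e ⟨a₁, rfl⟩ ⟨b₁, rfl⟩
      have h1 : a' * a₁ = b' * b₁ := by
        rw [← mul_assoc, ← mul_assoc] at hn
        exact mul_right_cancel hn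
      obtain ⟨z, hz⟩ := hm (a' * a₁) ⟨a₁, rfl⟩ ⟨b₁, h1⟩
      refine ⟨z, ?_⟩
      rw [← mul_assoc, hz, mul_assoc] at hd
      exact (mul_left_cancel hd).symm
  intro a b
  refine ⟨?_, hgcd a b⟩
  let P : ℕ → Prop := fun n => ∃ m, RightDvd a m ∧ RightDvd b m ∧ lam m = n
  have hP : ∃ n, P n := by
    obtain ⟨x, y, h⟩ := hcm a b
    exact ⟨_, x * a, ⟨x, rfl⟩, ⟨y, h⟩, rfl⟩
  classical
  obtain ⟨m, ham, hbm, hm⟩ := Nat.find_spec hP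
  refine ⟨m, ham, hbm, fun n han hbn => ?_⟩
  obtain ⟨d, ⟨z, hz⟩, hdn, hd⟩ := hgcd m n
  have hmin : lam m ≤ lam d :=
    hm ▸ Nat.find_min' hP ⟨d, hd a ham han, hd b hbm hbn, rfl⟩
  have hz1 : z = 1 := by
    by_contra hz1
    have := hadd z d
    have := hpos z hz1
    rw [hz] at hmin
    omega
  rw [hz1, one_mul] at hz
  rwa [hz]

end Monoids

/-- Ore's theorem: a cancellative monoid with common left multiples embeds in a group. -/
theorem exists_injective_hom_units {M : Type u} [Monoid M] [IsCancelMul M]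
    (hcm : ∀ a b : M, ∃ x y, x * a = y * b) :
    ∃ (N : Type u) (_ : Monoid N) (j : M →* Nˣ), Function.Injective j := by
  choose x y hxy using hcm
  let _ : OreLocalization.OreSet (⊤ : Submonoid M) :=
    { ore_right_cancel := fun r₁ r₂ s h => ⟨1, by rw [mul_right_cancel h]⟩
      oreNum := fun r s => y r s
      oreDenom := fun r s => ⟨x r s, trivial⟩
      ore_eq := fun r s => hxy r s }
  refine ⟨OreLocalization (⊤ : Submonoid M) M, inferInstance,
    Units.liftRight OreLocalization.numeratorHom
      (fun r => OreLocalization.numeratorUnit ⟨r, Submonoid.mem_top r⟩) fun r => rfl,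
    fun r r' h => ?_⟩
  have h' : OreLocalization.oreDiv r 1 = OreLocalization.oreDiv r' (1 : (⊤ : Submonoid M)) :=
    congrArg Units.val h
  obtain ⟨u, v, h1, h2⟩ := OreLocalization.oreDiv_eq_iff.1 h'
  simp only [OneMemClass.coe_one, mul_one] at h2
  rw [Submonoid.smul_def, ← h2] at h1
  exact (mul_left_cancel h1).symm

/-! ### The monoid of an interval that is a lattice -/

section IntervalMonoid

variable {B W : Type*} [Group W] {M : CoxeterMatrix B} (cs : CoxeterSystem M W)

/-- A lattice structure on the interval `[1, w]` whose order is the absolute order. -/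
class LatticeInterval (w : W) extends Lattice (Interval cs w) where
  le_iff : ∀ x y : Interval cs w, x ≤ y ↔ AbsLE cs x.1 y.1

/-- The defining relations of the interval monoid, the monoid with the same presentation as the
interval group. In a monoid, the relation `[1] = 1` has to be imposed. -/
def IntervalMonoidRel (w : W) (a b : FreeMonoid (Interval cs w)) : Prop :=
  (∃ u v r : Interval cs w, u.1 * v.1 = r.1 ∧ AbsLE cs u.1 r.1 ∧
    a = FreeMonoid.of u * FreeMonoid.of v ∧ b = FreeMonoid.of r) ∨
  (∃ e : Interval cs w, e.1 = 1 ∧ a = FreeMonoid.of e ∧ b = 1)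

/-- The interval monoid `M([1, w])`. -/
abbrev IntervalMonoid (w : W) : Type _ := PresentedMonoid (IntervalMonoidRel cs w)

variable {cs} {w : W}

namespace IntervalMonoid

/-- The generator of the interval monoid attached to an element of the interval. -/
abbrev of (x : Interval cs w) : IntervalMonoid cs w := PresentedMonoid.of _ x

theorem of_mul_of {u v r : Interval cs w} (h : u.1 * v.1 = r.1) (h' : AbsLE cs u.1 r.1) :
    of u * of v = of r :=
  PresentedMonoid.mk_eq_mk_of_rel (Or.inl ⟨u, v, r, h, h', rfl, rfl⟩)

theorem of_eq_one {e : Interval cs w} (h : e.1 = 1) : of e = 1 :=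
  PresentedMonoid.mk_eq_mk_of_rel (Or.inr ⟨e, h, rfl, rfl⟩)

@[elab_as_elim]
theorem induction {p : IntervalMonoid cs w → Prop} (m : IntervalMonoid cs w)
    (of : ∀ x, p (of x)) (one : p 1) (mul : ∀ a b, p a → p b → p (a * b)) : p m := by
  have hm : m ∈ Submonoid.closure (Set.range (PresentedMonoid.of (IntervalMonoidRel cs w))) := by
    rw [PresentedMonoid.closure_range_of]
    trivial
  induction hm using Submonoid.closure_induction with
  | mem x hx =>
    obtain ⟨y, rfl⟩ := hx
    exact of y
  | one => exact one
  | mul a b _ _ ha hb => exact mul a b ha hb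

/-- The universal property of the interval monoid. -/
def lift {N : Type*} [Monoid N] (f : Interval cs w → N)
    (hf : ∀ u v r : Interval cs w, u.1 * v.1 = r.1 → AbsLE cs u.1 r.1 → f u * f v = f r)
    (hf1 : ∀ e : Interval cs w, e.1 = 1 → f e = 1) : IntervalMonoid cs w →* N :=
  PresentedMonoid.lift f (by
    rintro a b (⟨u, v, r, h, h', rfl, rfl⟩ | ⟨e, he, rfl, rfl⟩)
    · simpa using hf u v r h h'
    · simpa using hf1 e he)

theorem hom_ext {N : Type*} [Monoid N] {f g : IntervalMonoid cs w →* N}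
    (h : ∀ x, f (of x) = g (of x)) : f = g := by
  refine MonoidHom.ext fun m => ?_
  induction m using induction with
  | of x => exact h x
  | one => simp
  | mul a b ha hb => simp [ha, hb]

variable (cs w) in
/-- The Garside element `[w]`. -/
def delta : IntervalMonoid cs w := of ⟨w, absLE_refl cs w⟩

variable (cs w) in
/-- The length function induced by the reflection length. -/
noncomputable def lengthHom : IntervalMonoid cs w →* Multiplicative ℕ :=
  lift (fun x => Multiplicative.ofAdd (reflectionLength cs x.1))
    (fun u v r h h' => by
      rw [← ofAdd_add, ← (absLE_mul_iff cs).1 (by rwa [h]), h])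
    (fun e he => by simp [he])

/-- The additive length of an element of the interval monoid. -/
noncomputable def len (m : IntervalMonoid cs w) : ℕ := (lengthHom cs w m).toAdd

theorem len_mul (a b : IntervalMonoid cs w) : len (a * b) = len a + len b := by
  simp [len]

theorem eq_one_of_len_eq_zero (m : IntervalMonoid cs w) (h : len m = 0) : m = 1 := by
  induction m using induction with
  | of x => exact of_eq_one ((reflectionLength_eq_zero cs).1 h)
  | one => rfl
  | mul a b ha hb =>
    rw [len_mul] at h
    rw [ha (by omega), hb (by omega), one_mul]

/-- The endomorphism of the interval monoid induced by conjugation with an element that commutes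
with `w`. -/
def conjHom (g : W) (hg : g * w * g⁻¹ = w) : IntervalMonoid cs w →* IntervalMonoid cs w :=
  lift (fun x => of ⟨g * x.1 * g⁻¹, by simpa only [hg] using x.2.conj cs g⟩)
    (fun u v r h h' => of_mul_of (by
      change g * u.1 * g⁻¹ * (g * v.1 * g⁻¹) = g * r.1 * g⁻¹
      rw [← h]
      group) (h'.conj cs g))
    (fun e he => of_eq_one (by simp [he]))

variable (cs w) in
/-- Conjugation by `w`. -/
def conjDelta : IntervalMonoid cs w →* IntervalMonoid cs w := conjHom w (mul_inv_cancel_right w w)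

variable (cs w) in
/-- Conjugation by `w⁻¹`. -/
def conjDeltaInv : IntervalMonoid cs w →* IntervalMonoid cs w := conjHom w⁻¹ (by simp)

theorem conjDelta_conjDeltaInv (m : IntervalMonoid cs w) :
    conjDelta cs w (conjDeltaInv cs w m) = m := by
  have : (conjDelta cs w).comp (conjDeltaInv cs w) = MonoidHom.id _ := by
    refine hom_ext fun x => congrArg of (Subtype.ext ?_)
    change w * (w⁻¹ * x.1 * w⁻¹⁻¹) * w⁻¹ = x.1
    group
  exact DFunLike.congr_fun this m

theorem of_mul_of_eq_delta {u v : Interval cs w} (h : u.1 * v.1 = w) :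
    of u * of v = delta cs w :=
  of_mul_of h u.2

/-- The Garside element is quasi-central: for a generator `[t]`, both sides factor through
`[w t⁻¹]`, since `[w t w⁻¹] [w t⁻¹] = [w] = [w t⁻¹] [t]`. -/
theorem delta_mul (m : IntervalMonoid cs w) :
    delta cs w * m = conjDelta cs w m * delta cs w := by
  induction m using induction with
  | of t =>
    let x : Interval cs w := ⟨w * t.1⁻¹, t.2.mul_inv cs⟩
    let t' : Interval cs w := ⟨w * t.1 * w⁻¹, by
      simpa [mul_assoc] using t.2.conj cs w⟩
    have h1 : of t' * of x = delta cs w :=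
      of_mul_of_eq_delta (by change w * t.1 * w⁻¹ * (w * t.1⁻¹) = w; group)
    have h2 : of x * of t = delta cs w :=
      of_mul_of_eq_delta (by change w * t.1⁻¹ * t.1 = w; group)
    change delta cs w * of t = of t' * delta cs w
    rw [← h2, ← mul_assoc (of t'), h1, h2]
  | one => simp
  | mul a b ha hb => rw [map_mul, ← mul_assoc, ha, mul_assoc, hb, mul_assoc]

theorem mul_delta (m : IntervalMonoid cs w) :
    m * delta cs w = delta cs w * conjDeltaInv cs w m := by
  rw [delta_mul, conjDelta_conjDeltaInv]

theorem of_leftDvd_delta (t : Interval cs w) : LeftDvd (of t) (delta cs w) :=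
  ⟨of ⟨t.1⁻¹ * w, t.2.inv_mul cs⟩, (of_mul_of_eq_delta (by simp)).symm⟩

theorem of_rightDvd_delta (t : Interval cs w) : RightDvd (of t) (delta cs w) :=
  ⟨of ⟨w * t.1⁻¹, t.2.mul_inv cs⟩, (of_mul_of_eq_delta (by simp)).symm⟩

theorem delta_pow_mul (k : ℕ) (m : IntervalMonoid cs w) :
    ∃ m', delta cs w ^ k * m = m' * delta cs w ^ k := by
  induction k with
  | zero => exact ⟨m, by simp⟩
  | succ k ih =>
    obtain ⟨m', h⟩ := ih
    exact ⟨conjDelta cs w m', by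
      rw [pow_succ', mul_assoc, h, ← mul_assoc, delta_mul, mul_assoc]⟩

/-- Every element can be completed on the left to a power of the Garside element. -/
theorem exists_mul_eq_delta_pow (m : IntervalMonoid cs w) :
    ∃ k x, x * m = delta cs w ^ k := by
  induction m using induction with
  | of t =>
    obtain ⟨x, hx⟩ := of_rightDvd_delta t
    exact ⟨1, x, by rw [← hx, pow_one]⟩
  | one => exact ⟨0, 1, by simp⟩
  | mul a b ha hb =>
    obtain ⟨k, x, hx⟩ := ha
    obtain ⟨l, y, hy⟩ := hb
    obtain ⟨y', hy'⟩ := delta_pow_mul k y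
    refine ⟨k + l, y' * x, ?_⟩
    rw [mul_assoc, ← mul_assoc x, hx, ← mul_assoc, ← hy', mul_assoc, hy, pow_add]

theorem exists_common_left_multiple (a b : IntervalMonoid cs w) : ∃ x y, x * a = y * b := by
  obtain ⟨k, x, hx⟩ := exists_mul_eq_delta_pow a
  obtain ⟨l, y, hy⟩ := exists_mul_eq_delta_pow b
  exact ⟨delta cs w ^ l * x, delta cs w ^ k * y, by
    rw [mul_assoc, mul_assoc, hx, hy, ← pow_add, ← pow_add, add_comm]⟩

end IntervalMonoid

end IntervalMonoid

/-! ### Complements and the Garside property -/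

section Complement

variable {B W : Type*} [Group W] {M : CoxeterMatrix B} {cs : CoxeterSystem M W} {w : W}
  [LatticeInterval cs w]

open LatticeInterval

namespace IntervalMonoid

theorem absLE_of_le {x y : Interval cs w} (h : x ≤ y) : AbsLE cs x.1 y.1 := (le_iff x y).1 h

/-- The complement `s⁻¹ (s ⊔ t)`. -/
def compl (s t : Interval cs w) : Interval cs w :=
  ⟨s.1⁻¹ * (s ⊔ t).1,
    ((absLE_of_le le_sup_left).inv_mul_absLE_inv_mul cs (s ⊔ t).2).trans cs (s.2.inv_mul cs)⟩

theorem mul_compl (s t : Interval cs w) : s.1 * (compl s t).1 = (s ⊔ t).1 :=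
  mul_inv_cancel_left _ _

theorem of_mul_of_compl (s t : Interval cs w) : of s * of (compl s t) = of (s ⊔ t) :=
  of_mul_of (mul_compl s t) (absLE_of_le le_sup_left)

/-- Left translation by `t` preserves joins, as long as it stays inside the interval. -/
theorem mul_sup {t u v r q : Interval cs w} (hr : t.1 * u.1 = r.1) (htr : AbsLE cs t.1 r.1)
    (hq : t.1 * v.1 = q.1) (htq : AbsLE cs t.1 q.1) : t.1 * (u ⊔ v).1 = (r ⊔ q).1 := by
  have hu : u.1 = t.1⁻¹ * r.1 := by rw [← hr, inv_mul_cancel_left]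
  have hv : v.1 = t.1⁻¹ * q.1 := by rw [← hq, inv_mul_cancel_left]
  have htm : AbsLE cs t.1 (r ⊔ q).1 := htr.trans cs (absLE_of_le le_sup_left)
  have hmw : AbsLE cs (t.1⁻¹ * (r ⊔ q).1) (t.1⁻¹ * w) :=
    htm.inv_mul_absLE_inv_mul cs (r ⊔ q).2
  let m : Interval cs w := ⟨t.1⁻¹ * (r ⊔ q).1, hmw.trans cs (t.2.inv_mul cs)⟩
  have hum : u ≤ m := by
    rw [le_iff, hu]
    exact htr.inv_mul_absLE_inv_mul cs (absLE_of_le le_sup_left)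
  have hvm : v ≤ m := by
    rw [le_iff, hv]
    exact htq.inv_mul_absLE_inv_mul cs (absLE_of_le le_sup_right)
  have huvm : AbsLE cs (u ⊔ v).1 m.1 := absLE_of_le (sup_le hum hvm)
  obtain ⟨ht, hw⟩ := t.2.of_absLE_inv_mul cs (huvm.trans cs hmw)
  let n : Interval cs w := ⟨t.1 * (u ⊔ v).1, hw⟩
  have hn : t.1⁻¹ * n.1 = (u ⊔ v).1 := inv_mul_cancel_left _ _
  have hrn : r ≤ n := by
    rw [le_iff, ← htr.inv_mul_inv_mul_iff cs ht, ← hu]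
    change AbsLE cs u.1 (t.1⁻¹ * n.1)
    rw [hn]
    exact absLE_of_le le_sup_left
  have hqn : q ≤ n := by
    rw [le_iff, ← htq.inv_mul_inv_mul_iff cs ht, ← hv]
    change AbsLE cs v.1 (t.1⁻¹ * n.1)
    rw [hn]
    exact absLE_of_le le_sup_right
  have hmn : AbsLE cs m.1 (u ⊔ v).1 := by
    rw [← hn]
    exact htm.inv_mul_absLE_inv_mul cs (absLE_of_le (sup_le hrn hqn))
  rw [AbsLE.antisymm cs huvm hmn]
  exact mul_inv_cancel_left _ _

theorem compl_sup (t s s' : Interval cs w) : compl t (s ⊔ s') = compl t s ⊔ compl t s' := by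
  refine Subtype.ext (mul_left_cancel (a := t.1) ?_)
  rw [mul_sup (mul_compl t s) (absLE_of_le le_sup_left) (mul_compl t s')
    (absLE_of_le le_sup_left)]
  refine (mul_compl t (s ⊔ s')).trans ?_
  rw [sup_sup_distrib_left]

theorem mul_compl_sup {t u r : Interval cs w} (h : t.1 * u.1 = r.1) (h' : AbsLE cs t.1 r.1)
    (s : Interval cs w) : t.1 * (compl t s ⊔ u).1 = (s ⊔ r).1 := by
  rw [mul_sup (mul_compl t s) (absLE_of_le le_sup_left) h h']
  have htr : t ≤ r := (le_iff t r).2 h'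
  rw [sup_comm t s, sup_assoc, sup_eq_right.2 htr]

/-- The complement of `s` along `r = t u` is computed in two steps, along `t` and then along `u`. -/
theorem compl_compl {t u r : Interval cs w} (h : t.1 * u.1 = r.1) (h' : AbsLE cs t.1 r.1)
    (s : Interval cs w) : compl u (compl t s) = compl r s := by
  refine Subtype.ext (mul_left_cancel (a := r.1) ?_)
  refine Eq.trans ?_ (mul_compl r s).symm
  rw [sup_comm, ← mul_compl_sup h h' s, sup_comm, ← mul_compl, ← mul_assoc, h]

theorem of_compl_mul_of_compl {t u r : Interval cs w} (h : t.1 * u.1 = r.1)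
    (h' : AbsLE cs t.1 r.1) (s : Interval cs w) :
    of (compl s t) * of (compl (compl t s) u) = of (compl s r) := by
  refine of_mul_of (mul_left_cancel (a := s.1) ?_) ?_
  · rw [← mul_assoc, mul_compl, sup_comm s t, ← mul_compl t s, mul_assoc, mul_compl,
      mul_compl_sup h h', mul_compl]
  · have htr : t ≤ r := (le_iff t r).2 h'
    exact (absLE_of_le le_sup_left).inv_mul_absLE_inv_mul cs
      (absLE_of_le (sup_le_sup_left htr s))

theorem le_of_val_eq_one {e : Interval cs w} (he : e.1 = 1) (x : Interval cs w) : e ≤ x :=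
  (le_iff e x).2 (he ▸ absLE_one_left cs x.1)

theorem compl_one_left {e : Interval cs w} (he : e.1 = 1) (x : Interval cs w) :
    compl e x = x := by
  refine Subtype.ext ?_
  have := mul_compl e x
  rwa [he, one_mul, sup_eq_right.2 (le_of_val_eq_one he x)] at this

theorem compl_eq_one_iff {s t : Interval cs w} : (compl s t).1 = 1 ↔ t ≤ s := by
  change s.1⁻¹ * (s ⊔ t).1 = 1 ↔ _
  rw [inv_mul_eq_one, ← sup_eq_left]
  exact ⟨fun h => (Subtype.ext h).symm, fun h => by rw [h]⟩

/-- One step of the right action of the interval monoid on pairs: the first entry is replaced by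
its complement along `t`, and the second entry accumulates the opposite complement. -/
def complStep (t : Interval cs w) (p : Interval cs w × IntervalMonoid cs w) :
    Interval cs w × IntervalMonoid cs w :=
  (compl t p.1, p.2 * of (compl p.1 t))

variable (cs w) in
/-- The right action of the interval monoid generated by `complStep`. It shows that complements
with respect to arbitrary elements of the monoid are well defined. -/
def complHom : IntervalMonoid cs w →*
    (Function.End (Interval cs w × IntervalMonoid cs w))ᵐᵒᵖ :=
  lift (fun t => MulOpposite.op (complStep t))
    (fun t u r h h' => MulOpposite.unop_injective (funext fun p => Prod.ext
      (compl_compl h h' p.1) (by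
        change p.2 * of (compl p.1 t) * of (compl (compl t p.1) u) = p.2 * of (compl p.1 r)
        rw [mul_assoc, of_compl_mul_of_compl h h'])))
    (fun e he => MulOpposite.unop_injective (funext fun p => Prod.ext
      (compl_one_left he p.1) (by
        change p.2 * of (compl p.1 e) = p.2
        rw [of_eq_one (compl_eq_one_iff.2 (le_of_val_eq_one he _)), mul_one])))

/-- The value of the action `complHom`. -/
def complAct (m : IntervalMonoid cs w) (p : Interval cs w × IntervalMonoid cs w) :
    Interval cs w × IntervalMonoid cs w :=
  (complHom cs w m).unop p

theorem complAct_of (t : Interval cs w) (p) : complAct (of t) p = complStep t p := rfl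

theorem complAct_one (p : Interval cs w × IntervalMonoid cs w) : complAct 1 p = p := by
  rw [complAct, map_one]
  rfl

theorem complAct_mul (m n : IntervalMonoid cs w) (p) :
    complAct (m * n) p = complAct n (complAct m p) := by
  rw [complAct, map_mul]
  rfl

/-- The complement `m \ s` of a generator along an element of the monoid. -/
def rightCompl (m : IntervalMonoid cs w) (s : Interval cs w) : Interval cs w :=
  (complAct m (s, 1)).1

/-- The complement `s \ m` of an element of the monoid along a generator. -/
def leftCompl (s : Interval cs w) (m : IntervalMonoid cs w) : IntervalMonoid cs w :=
  (complAct m (s, 1)).2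

theorem complAct_eq (m : IntervalMonoid cs w) (s : Interval cs w) (x : IntervalMonoid cs w) :
    complAct m (s, x) = (rightCompl m s, x * leftCompl s m) := by
  suffices h : ∀ (y : IntervalMonoid cs w) (s) (x), complAct m (s, y * x) =
      ((complAct m (s, x)).1, y * (complAct m (s, x)).2) by
    have := h x s 1
    rwa [mul_one] at this
  induction m using induction with
  | of t =>
    intro y s x
    simp only [complAct_of, complStep, mul_assoc]
  | one =>
    intro y s x
    simp only [complAct_one]
  | mul a b ha hb =>
    intro y s x
    rw [complAct_mul, ha, hb, complAct_mul]

theorem rightCompl_of (t s : Interval cs w) : rightCompl (of t) s = compl t s := rfl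

theorem leftCompl_of (s t : Interval cs w) : leftCompl s (of t) = of (compl s t) :=
  one_mul _

theorem rightCompl_mul (m n : IntervalMonoid cs w) (s : Interval cs w) :
    rightCompl (m * n) s = rightCompl n (rightCompl m s) := by
  rw [rightCompl, complAct_mul, complAct_eq, complAct_eq]

theorem leftCompl_mul (m n : IntervalMonoid cs w) (s : Interval cs w) :
    leftCompl s (m * n) = leftCompl s m * leftCompl (rightCompl m s) n := by
  rw [leftCompl, complAct_mul, complAct_eq, complAct_eq, one_mul]

theorem rightCompl_one (s : Interval cs w) : rightCompl 1 s = s := by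
  rw [rightCompl, complAct_one]

theorem leftCompl_one (s : Interval cs w) : leftCompl s 1 = 1 := by
  rw [leftCompl, complAct_one]

/-- The complement square closes: `s (s \ m) = m (m \ s)`. -/
theorem of_mul_leftCompl (s : Interval cs w) (m : IntervalMonoid cs w) :
    of s * leftCompl s m = m * of (rightCompl m s) := by
  induction m using induction generalizing s with
  | of t => rw [leftCompl_of, rightCompl_of, of_mul_of_compl, of_mul_of_compl, sup_comm]
  | one => rw [leftCompl_one, rightCompl_one, mul_one, one_mul]
  | mul a b ha hb =>
    rw [leftCompl_mul, rightCompl_mul, ← mul_assoc, ha, mul_assoc, hb, mul_assoc]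

theorem complAct_val_eq_one {e : Interval cs w} (he : e.1 = 1) (m : IntervalMonoid cs w) :
    (rightCompl m e).1 = 1 ∧ leftCompl e m = m := by
  induction m using induction generalizing e with
  | of t =>
    rw [rightCompl_of, leftCompl_of, compl_one_left he, compl_eq_one_iff]
    exact ⟨le_of_val_eq_one he t, rfl⟩
  | one => exact ⟨by rwa [rightCompl_one], leftCompl_one e⟩
  | mul a b ha hb =>
    rw [rightCompl_mul, leftCompl_mul, (ha he).2, (hb (ha he).1).2]
    exact ⟨(hb (ha he).1).1, rfl⟩

/-- The map `m ↦ s \ m` is a left inverse of left multiplication by the generator `s`. -/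
theorem leftCompl_of_mul (s : Interval cs w) (m : IntervalMonoid cs w) :
    (rightCompl (of s * m) s).1 = 1 ∧ leftCompl s (of s * m) = m := by
  have hs : (compl s s).1 = 1 := compl_eq_one_iff.2 le_rfl
  rw [rightCompl_mul, leftCompl_mul, rightCompl_of, leftCompl_of, of_eq_one hs, one_mul]
  exact complAct_val_eq_one hs m

instance : IsLeftCancelMul (IntervalMonoid cs w) where
  mul_left_cancel a b c h := by
    replace h : a * b = a * c := h
    induction a using induction generalizing b c with
    | of s => rw [← (leftCompl_of_mul s b).2, ← (leftCompl_of_mul s c).2, h]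
    | one => simpa using h
    | mul x y hx hy =>
      rw [mul_assoc, mul_assoc] at h
      exact hy _ _ (hx _ _ h)

/-- The generator `s` divides `m` if and only if its complement along `m` is trivial. -/
theorem of_leftDvd_iff {s : Interval cs w} {m : IntervalMonoid cs w} :
    LeftDvd (of s) m ↔ (rightCompl m s).1 = 1 := by
  constructor
  · rintro ⟨n, rfl⟩
    exact (leftCompl_of_mul s n).1
  · intro h
    exact ⟨leftCompl s m, by rw [of_mul_leftCompl, of_eq_one h, mul_one]⟩

theorem of_leftDvd_of_iff {s t : Interval cs w} : LeftDvd (of s) (of t) ↔ s ≤ t := by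
  rw [of_leftDvd_iff, rightCompl_of, compl_eq_one_iff]

/-- Complements along any element of the monoid preserve joins, so that the least common multiple of
two generators is their join in the interval. -/
theorem rightCompl_sup (m : IntervalMonoid cs w) (s t : Interval cs w) :
    rightCompl m (s ⊔ t) = rightCompl m s ⊔ rightCompl m t := by
  induction m using induction generalizing s t with
  | of x => exact compl_sup x s t
  | one => simp only [rightCompl_one]
  | mul a b ha hb => simp only [rightCompl_mul, ha, hb]

theorem isLeftLcm_of_sup (s t : Interval cs w) : IsLeftLcm (of s) (of t) (of (s ⊔ t)) := by
  refine ⟨of_leftDvd_of_iff.2 le_sup_left, of_leftDvd_of_iff.2 le_sup_right, fun m hs ht => ?_⟩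
  rw [of_leftDvd_iff] at *
  rw [rightCompl_sup, Subtype.ext (hs.trans ht.symm), sup_idem, ht]

theorem exists_isLeftLcm (a b : IntervalMonoid cs w) : ∃ m, IsLeftLcm a b m := by
  refine exists_isLeftLcm_of_closure_eq_top (PresentedMonoid.closure_range_of _) ?_ a b
  rintro _ ⟨s, rfl⟩ _ ⟨t, rfl⟩
  refine ⟨of (compl t s), ⟨_, rfl⟩, ?_⟩
  change IsLeftLcm (of s) (of t) (of t * of (compl t s))
  rw [of_mul_of_compl, sup_comm]
  exact isLeftLcm_of_sup s t

instance : IsCancelMul (IntervalMonoid cs w) where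
  mul_right_cancel a b c h := by
    replace h : b * a = c * a := h
    -- A right factor `a` can be completed to a power of the quasi-central element `[w]`.
    have key (x y : IntervalMonoid cs w) (k : ℕ)
        (h : x * delta cs w ^ k = y * delta cs w ^ k) : x = y := by
      induction k with
      | zero => simpa using h
      | succ k ih =>
        rw [pow_succ, ← mul_assoc, ← mul_assoc, mul_delta, mul_delta] at h
        have h' := congrArg (conjDelta cs w) (mul_left_cancel h)
        rw [conjDelta_conjDeltaInv, conjDelta_conjDeltaInv] at h'
        exact ih h'
    induction a using induction generalizing b c with
    | of s =>
      refine key b c 1 ?_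
      obtain ⟨t, ht⟩ := of_leftDvd_delta s
      rw [pow_one, ht, ← mul_assoc, ← mul_assoc, h]
    | one => simpa using h
    | mul x y hx hy =>
      rw [← mul_assoc, ← mul_assoc] at h
      exact hx _ _ (hy _ _ h)

theorem leftDvd_delta_iff_rightDvd (a : IntervalMonoid cs w) :
    LeftDvd a (delta cs w) ↔ RightDvd a (delta cs w) := by
  constructor
  · rintro ⟨c, hc⟩
    refine ⟨conjDelta cs w c, mul_right_cancel (b := c) ?_⟩
    rw [delta_mul, mul_assoc, ← hc]
  · rintro ⟨c, hc⟩
    refine ⟨conjDeltaInv cs w c, mul_left_cancel (a := c) ?_⟩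
    rw [mul_delta, ← mul_assoc, ← hc]

/-- Left divisors of generators are generators. -/
theorem exists_eq_of_of_leftDvd_of {a : IntervalMonoid cs w} {r : Interval cs w}
    (h : LeftDvd a (of r)) : ∃ x, a = of x := by
  induction a using induction generalizing r with
  | of x => exact ⟨x, rfl⟩
  | one => exact ⟨⟨1, absLE_one_left cs w⟩, (of_eq_one rfl).symm⟩
  | mul a b ha hb =>
    obtain ⟨s, rfl⟩ := ha ((leftDvd_mul_right a b).trans h)
    obtain ⟨c, hc⟩ := h
    have hsr : s ≤ r := of_leftDvd_of_iff.1 ⟨b * c, by rw [hc, mul_assoc]⟩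
    have hr : of s * of (compl s r) = of r := by rw [of_mul_of_compl, sup_eq_right.2 hsr]
    have hbc : of (compl s r) = b * c := by
      rw [← hr, mul_assoc] at hc
      exact mul_left_cancel hc
    obtain ⟨t, rfl⟩ := hb ⟨c, hbc⟩
    have ht : t ≤ compl s r := of_leftDvd_of_iff.1 ⟨c, hbc⟩
    have hw : AbsLE cs (s.1⁻¹ * (s ⊔ r).1) (s.1⁻¹ * w) :=
      (absLE_of_le le_sup_left).inv_mul_absLE_inv_mul cs (s ⊔ r).2
    obtain ⟨h1, h2⟩ := s.2.of_absLE_inv_mul cs ((absLE_of_le ht).trans cs hw)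
    exact ⟨⟨s.1 * t.1, h2⟩, of_mul_of rfl h1⟩

variable (cs w) in
theorem isGarsideMonoid [Finite (Interval cs w)] :
    IsGarsideMonoid (IntervalMonoid cs w) (delta cs w) where
  cancel := inferInstance
  length := ⟨len, fun a b => (len_mul a b).ge, fun a => mt (eq_one_of_len_eq_zero a)⟩
  left_lcm_gcd := hasLcmGcd_leftDvd (lam := len) (fun a b => (len_mul a b).ge)
    (fun a => mt (eq_one_of_len_eq_zero a)) exists_isLeftLcm
  right_lcm_gcd := hasLcmGcd_rightDvd (lam := len) (fun a b => (len_mul a b).ge)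
    (fun a => mt (eq_one_of_len_eq_zero a)) exists_isLeftLcm exists_common_left_multiple
  balanced := leftDvd_delta_iff_rightDvd
  generate := by
    rw [eq_top_iff, ← PresentedMonoid.closure_range_of, Submonoid.closure_le]
    rintro _ ⟨t, rfl⟩
    exact Submonoid.subset_closure (of_leftDvd_delta t)
  finite := by
    refine (Set.finite_range (of : Interval cs w → IntervalMonoid cs w)).subset fun a ha => ?_
    obtain ⟨x, rfl⟩ := exists_eq_of_of_leftDvd_of ha
    exact ⟨x, rfl⟩

end IntervalMonoid

end Complement

section GroupOfFractions

variable {B : Type*} {W : Type u} [Group W] {M : CoxeterMatrix B} (cs : CoxeterSystem M W) {w : W}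

theorem IntervalGroup.of_mul_of {u v r : Interval cs w} (h : u.1 * v.1 = r.1)
    (h' : AbsLE cs u.1 r.1) : (PresentedGroup.of u * PresentedGroup.of v : IntervalGroup cs w) =
      PresentedGroup.of r := by
  rw [← mul_inv_eq_one]
  exact PresentedGroup.one_of_mem ⟨u, v, r, h, h', rfl⟩

theorem IntervalGroup.of_eq_one {e : Interval cs w} (h : e.1 = 1) :
    (PresentedGroup.of e : IntervalGroup cs w) = 1 :=
  mul_eq_left.1 (IntervalGroup.of_mul_of cs (u := e) (v := e) (r := e) (by rw [h, mul_one])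
    (absLE_refl cs _))

/-- A homomorphism out of the interval group. -/
def IntervalGroup.lift {G : Type*} [Group G] (f : Interval cs w → G)
    (hf : ∀ u v r : Interval cs w, u.1 * v.1 = r.1 → AbsLE cs u.1 r.1 → f u * f v = f r) :
    IntervalGroup cs w →* G :=
  PresentedGroup.toGroup (f := f) (by
    rintro _ ⟨u, v, r, h, h', rfl⟩
    simp [hf u v r h h'])

@[simp]
theorem IntervalGroup.lift_of {G : Type*} [Group G] (f : Interval cs w → G) (hf)
    (x : Interval cs w) : IntervalGroup.lift cs f hf (PresentedGroup.of x) = f x :=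
  PresentedGroup.toGroup.of _

variable (w) in
/-- The natural map from the interval monoid to the interval group. -/
def IntervalMonoid.toIntervalGroup : IntervalMonoid cs w →* IntervalGroup cs w :=
  IntervalMonoid.lift PresentedGroup.of (fun _ _ _ h h' => IntervalGroup.of_mul_of cs h h')
    (fun _ he => IntervalGroup.of_eq_one cs he)

/-- The interval group of a finite interval that is a lattice is a Garside group. -/
theorem isGarsideGroup_of_intervalIsLattice [Finite (Interval cs w)]
    (hL : IntervalIsLattice cs w) : IsGarsideGroup (IntervalGroup cs w) := by
  obtain ⟨L, hL⟩ := hL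
  let _ : LatticeInterval cs w := { L with le_iff := hL }
  refine ⟨IntervalMonoid cs w, inferInstance, IntervalMonoid.delta cs w,
    IntervalMonoid.toIntervalGroup cs w, IntervalMonoid.isGarsideMonoid cs w, ?_, ?_⟩
  · obtain ⟨N, _, j, hj⟩ := exists_injective_hom_units
      (IntervalMonoid.exists_common_left_multiple (cs := cs) (w := w))
    have hf (u v r : Interval cs w) (h : u.1 * v.1 = r.1) (h' : AbsLE cs u.1 r.1) :
        j (IntervalMonoid.of u) * j (IntervalMonoid.of v) = j (IntervalMonoid.of r) := by
      rw [← map_mul, IntervalMonoid.of_mul_of h h']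
    let k : IntervalGroup cs w →* Nˣ := IntervalGroup.lift cs (fun x => j (IntervalMonoid.of x)) hf
    have hk : k.comp (IntervalMonoid.toIntervalGroup cs w) = j :=
      IntervalMonoid.hom_ext fun x =>
        IntervalGroup.lift_of cs (fun x => j (IntervalMonoid.of x)) hf x
    rw [← hk] at hj
    exact Function.Injective.of_comp hj
  · set ι := IntervalMonoid.toIntervalGroup cs w
    intro g
    have hg : g ∈ Subgroup.closure
        (Set.range (PresentedGroup.of (rels := intervalRelators cs w))) := by
      rw [PresentedGroup.closure_range_of]
      trivial
    induction hg using Subgroup.closure_induction with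
    | mem x hx =>
      obtain ⟨y, rfl⟩ := hx
      exact ⟨1, IntervalMonoid.of y, by rw [map_one, inv_one, one_mul]; rfl⟩
    | one => exact ⟨1, 1, by simp⟩
    | mul x y _ _ hx hy =>
      obtain ⟨a, b, rfl⟩ := hx
      obtain ⟨c, d, rfl⟩ := hy
      obtain ⟨p, q, hpq⟩ := IntervalMonoid.exists_common_left_multiple b c
      refine ⟨p * a, q * d, ?_⟩
      have hpq' := congrArg ι hpq
      rw [map_mul, map_mul] at hpq'
      rw [map_mul, map_mul, eq_inv_mul_of_mul_eq hpq']
      group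
    | inv x _ hx =>
      obtain ⟨a, b, rfl⟩ := hx
      exact ⟨b, a, by simp⟩

end GroupOfFractions

/-! ### Intervals of rank three -/

section RankThree

variable {B W : Type*} [Group W] {M : CoxeterMatrix B} (cs : CoxeterSystem M W) {w : W}

theorem AbsLE.length_le {x y : W} (h : AbsLE cs x y) :
    reflectionLength cs x ≤ reflectionLength cs y := by
  unfold AbsLE at h
  omega

theorem AbsLE.eq_of_length_le {x y : W} (h : AbsLE cs x y)
    (hl : reflectionLength cs y ≤ reflectionLength cs x) : x = y := by
  unfold AbsLE at h
  rw [← inv_mul_eq_one, ← reflectionLength_eq_zero cs]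
  omega

/-- An interval of rank three has meets if two distinct reflections have at most one common upper
bound of length two. -/
theorem exists_meet_of_length_eq_three (hw : reflectionLength cs w = 3)
    (h : ∀ t t' r r' : W, cs.IsReflection t → cs.IsReflection t' → t ≠ t' →
      reflectionLength cs r = 2 → reflectionLength cs r' = 2 → AbsLE cs r w → AbsLE cs r' w →
      AbsLE cs t r → AbsLE cs t' r → AbsLE cs t r' → AbsLE cs t' r' → r = r')
    {x y : W} (hx : AbsLE cs x w) (hy : AbsLE cs y w) :
    ∃ d, AbsLE cs d x ∧ AbsLE cs d y ∧ ∀ z, AbsLE cs z x → AbsLE cs z y → AbsLE cs z d := by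
  -- A common lower bound of maximal length is the greatest one.
  let P : ℕ → Prop := fun n => ∃ d, AbsLE cs d x ∧ AbsLE cs d y ∧ reflectionLength cs d = n
  have h0 : P 0 :=
    ⟨1, absLE_one_left cs x, absLE_one_left cs y, reflectionLength_one cs⟩
  have hP : ∀ n, P n → n ≤ 3 := by
    rintro n ⟨d, hd, -, rfl⟩
    exact hw ▸ (hd.trans cs hx).length_le cs
  classical
  obtain ⟨d, hdx, hdy, hd⟩ := Nat.findGreatest_spec (hP _ h0) h0
  have hmax (z : W) (hzx : AbsLE cs z x) (hzy : AbsLE cs z y) :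
      reflectionLength cs z ≤ reflectionLength cs d := by
    have hz : P (reflectionLength cs z) := ⟨z, hzx, hzy, rfl⟩
    exact hd ▸ Nat.le_findGreatest (hP _ hz) hz
  refine ⟨d, hdx, hdy, fun z hzx hzy => ?_⟩
  have hzd := hmax z hzx hzy
  have hx3 := hw ▸ hx.length_le cs
  have hy3 := hw ▸ hy.length_le cs
  have hdx' := hdx.length_le cs
  have hdy' := hdy.length_le cs
  rcases Nat.eq_zero_or_pos (reflectionLength cs z) with hz0 | hz0
  · rw [(reflectionLength_eq_zero cs).1 hz0]
    exact absLE_one_left cs d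
  by_cases hxd : reflectionLength cs x = reflectionLength cs d
  · rwa [hdx.eq_of_length_le cs hxd.le]
  by_cases hyd : reflectionLength cs y = reflectionLength cs d
  · rwa [hdy.eq_of_length_le cs hyd.le]
  -- If `x` or `y` is `w`, then the other one is a common lower bound.
  have hxw : reflectionLength cs x ≠ 3 := fun h3 => by
    have hxw := hx.eq_of_length_le cs (by omega)
    have := hmax y (hxw ▸ hy) (absLE_refl cs y)
    omega
  have hyw : reflectionLength cs y ≠ 3 := fun h3 => by
    have hyw := hy.eq_of_length_le cs (by omega)
    have := hmax x (absLE_refl cs x) (hyw ▸ hx)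
    omega
  by_contra hne
  have hzd' : z ≠ d := fun e => hne (e ▸ absLE_refl cs z)
  have hxy := h z d x y (isReflection_of_reflectionLength_eq_one cs (by omega))
    (isReflection_of_reflectionLength_eq_one cs (by omega)) hzd' (by omega) (by omega) hx hy
    hzx hdx hzy hdy
  have := hmax x (absLE_refl cs x) (hxy ▸ absLE_refl cs x)
  omega

/-- Since complementation `x ↦ x⁻¹ w` reverses the absolute order, an interval with meets is a
lattice. -/
theorem intervalIsLattice_of_exists_meet
    (h : ∀ x y : W, AbsLE cs x w → AbsLE cs y w →
      ∃ d, AbsLE cs d x ∧ AbsLE cs d y ∧ ∀ z, AbsLE cs z x → AbsLE cs z y → AbsLE cs z d) :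
    IntervalIsLattice cs w := by
  have hcompl {x y : W} (hxy : AbsLE cs x y) (hy : AbsLE cs y w) :
      AbsLE cs (y⁻¹ * w) (x⁻¹ * w) := by
    have h1 : AbsLE cs (x⁻¹ * y) (x⁻¹ * w) := hxy.inv_mul_absLE_inv_mul cs hy
    have := h1.inv_mul cs
    rwa [show (x⁻¹ * y)⁻¹ * (x⁻¹ * w) = y⁻¹ * w by group] at this
  have hcompl' {x y : W} (hxy : AbsLE cs x y) (hy : AbsLE cs y w) :
      AbsLE cs (w * y⁻¹) (w * x⁻¹) := by
    have := (hcompl hxy hy).conj cs w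
    rwa [show w * (y⁻¹ * w) * w⁻¹ = w * y⁻¹ by group,
      show w * (x⁻¹ * w) * w⁻¹ = w * x⁻¹ by group] at this
  have hjoin (x y : W) (hx : AbsLE cs x w) (hy : AbsLE cs y w) : ∃ d, AbsLE cs d w ∧
      AbsLE cs x d ∧ AbsLE cs y d ∧
      ∀ z, AbsLE cs z w → AbsLE cs x z → AbsLE cs y z → AbsLE cs d z := by
    obtain ⟨d, hdx, hdy, hd⟩ := h (x⁻¹ * w) (y⁻¹ * w) (hx.inv_mul cs) (hy.inv_mul cs)
    have hinv (u : W) : w * (u⁻¹ * w)⁻¹ = u := by group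
    refine ⟨w * d⁻¹, (hdx.trans cs (hx.inv_mul cs)).mul_inv cs, ?_, ?_, fun z hz hxz hyz => ?_⟩
    · simpa only [hinv] using hcompl' hdx (hx.inv_mul cs)
    · simpa only [hinv] using hcompl' hdy (hy.inv_mul cs)
    · have := hcompl' (hd _ (hcompl hxz hz) (hcompl hyz hz)) (hdx.trans cs (hx.inv_mul cs))
      rwa [hinv] at this
  choose inf hinf using fun x y : Interval cs w => h x.1 y.1 x.2 y.2
  choose sup hsup using fun x y : Interval cs w => hjoin x.1 y.1 x.2 y.2
  exact ⟨
    { le := fun x y => AbsLE cs x.1 y.1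
      le_refl := fun x => absLE_refl cs x.1
      le_trans := fun x y z hxy hyz => hxy.trans cs hyz
      le_antisymm := fun x y hxy hyx => Subtype.ext (hxy.antisymm cs hyx)
      inf := fun x y => ⟨inf x y, (hinf x y).1.trans cs x.2⟩
      inf_le_left := fun x y => (hinf x y).1
      inf_le_right := fun x y => (hinf x y).2.1
      le_inf := fun x y z hxy hxz => (hinf y z).2.2 x.1 hxy hxz
      sup := fun x y => ⟨sup x y, (hsup x y).1⟩
      le_sup_left := fun x y => (hsup x y).2.1
      le_sup_right := fun x y => (hsup x y).2.2.1
      sup_le := fun x y z hxz hyz => (hsup x y).2.2.2 z.1 z.2 hxz hyz }, fun _ _ => Iff.rfl⟩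

variable {G : Type*} [Group G]

open Classical in
/-- The extension to the interval of a map defined on reflections: elements of length two are sent
to complements of the images of reflections. -/
noncomputable def extendRankThree (w : W) (τ : W → G) (c : G) (x : W) : G :=
  if reflectionLength cs x = 0 then 1
  else if reflectionLength cs x = 1 then τ x
  else if reflectionLength cs x = 2 then (τ (w * x⁻¹))⁻¹ * c
  else c

/-- An interval of rank three in which every reflection lies below `w` has the presentation with
one generator for each reflection and the relations expressing that `τ t * τ u * τ v` does not
depend on the factorization `w = t * u * v` into reflections. -/
theorem exists_intervalGroup_hom (hw : reflectionLength cs w = 3)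
    (hle : ∀ t : W, cs.IsReflection t → AbsLE cs t w) (τ : W → G) (c : G)
    (hτ : ∀ t u v : W, cs.IsReflection t → cs.IsReflection u → cs.IsReflection v →
      t * u * v = w → τ t * τ u * τ v = c) :
    ∃ φ : IntervalGroup cs w →* G,
      ∀ t : Interval cs w, cs.IsReflection t.1 → φ (PresentedGroup.of t) = τ t.1 := by
  have e0 {x : W} (h : reflectionLength cs x = 0) : extendRankThree cs w τ c x = 1 := by
    simp [extendRankThree, h]
  have e1 {x : W} (h : reflectionLength cs x = 1) : extendRankThree cs w τ c x = τ x := by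
    simp [extendRankThree, h]
  have e2 {x : W} (h : reflectionLength cs x = 2) :
      extendRankThree cs w τ c x = (τ (w * x⁻¹))⁻¹ * c := by
    simp [extendRankThree, h]
  have e3 : extendRankThree cs w τ c w = c := by
    simp [extendRankThree, hw]
  -- The Hurwitz move `(t, u, v) ↦ (u, v, w⁻¹ t w)` shows that `τ` is equivariant.
  have hconj {t : W} (ht : cs.IsReflection t) : τ (w * t * w⁻¹) * c = c * τ t := by
    have ht' : cs.IsReflection (w * t * w⁻¹) := ht.conj w
    have hlen := hle _ ht'
    rw [AbsLE, hw, (reflectionLength_eq_one cs).2 ht'] at hlen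
    obtain ⟨l, hl, hl2⟩ := exists_reduced_isReflectionWord cs ((w * t * w⁻¹)⁻¹ * w)
    rw [show reflectionLength cs ((w * t * w⁻¹)⁻¹ * w) = 2 by omega,
      List.length_eq_two] at hl2
    obtain ⟨u, v, rfl⟩ := hl2
    have huv := hl.2
    simp only [List.prod_cons, List.prod_nil, mul_one] at huv
    have hu := hl.1 u (by simp)
    have hv := hl.1 v (by simp)
    have h1 := hτ _ u v ht' hu hv (by rw [mul_assoc, huv]; group)
    have h2 := hτ u v t hu hv ht (by rw [huv]; group)
    calc τ (w * t * w⁻¹) * c = τ (w * t * w⁻¹) * (τ u * τ v * τ t) := by rw [h2]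
      _ = τ (w * t * w⁻¹) * τ u * τ v * τ t := by simp only [mul_assoc]
      _ = c * τ t := by rw [h1]
  refine ⟨IntervalGroup.lift cs (fun x => extendRankThree cs w τ c x.1) ?_, fun t ht => ?_⟩
  swap
  · rw [IntervalGroup.lift_of, e1 ((reflectionLength_eq_one cs).2 ht)]
  rintro u v r huv hur
  have hr := r.2.length_le cs
  have hsum : reflectionLength cs r.1 = reflectionLength cs u.1 + reflectionLength cs v.1 := by
    rw [← huv] at hur ⊢
    exact (absLE_mul_iff cs).1 hur
  rw [hw] at hr
  rcases Nat.eq_zero_or_pos (reflectionLength cs u.1) with hu | hu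
  · rw [e0 hu, one_mul, ← huv, (reflectionLength_eq_zero cs).1 hu, one_mul]
  rcases Nat.eq_zero_or_pos (reflectionLength cs v.1) with hv | hv
  · rw [e0 hv, mul_one, ← huv, (reflectionLength_eq_zero cs).1 hv, mul_one]
  have hr3 : reflectionLength cs r.1 = 3 → r.1 = w := fun h => r.2.eq_of_length_le cs (by omega)
  obtain ⟨hu1, hv1⟩ | ⟨hu1, hv2⟩ | ⟨hu2, hv1⟩ :
      (reflectionLength cs u.1 = 1 ∧ reflectionLength cs v.1 = 1) ∨
      (reflectionLength cs u.1 = 1 ∧ reflectionLength cs v.1 = 2) ∨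
      (reflectionLength cs u.1 = 2 ∧ reflectionLength cs v.1 = 1) := by omega
  · have hr2 : reflectionLength cs r.1 = 2 := by omega
    have hx : reflectionLength cs (w * r.1⁻¹) = 1 := by
      have := r.2.mul_inv cs
      rw [AbsLE, show (w * r.1⁻¹)⁻¹ * w = r.1 by group] at this
      omega
    rw [e1 hu1, e1 hv1, e2 hr2, eq_inv_mul_iff_mul_eq, ← mul_assoc]
    rw [reflectionLength_eq_one] at hu1 hv1 hx
    exact hτ _ _ _ hx hu1 hv1 (by rw [mul_assoc, huv]; group)
  · rw [hr3 (by omega)] at huv ⊢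
    rw [e1 hu1, e2 hv2, e3, ← eq_mul_inv_of_mul_eq huv, mul_inv_cancel_left]
  · rw [hr3 (by omega)] at huv ⊢
    rw [e2 hu2, e1 hv1, e3, mul_assoc, inv_mul_eq_iff_eq_mul,
      ← hconj ((reflectionLength_eq_one cs).1 hv1)]
    have : u.1⁻¹ = v.1 * w⁻¹ := by
      rw [eq_mul_inv_iff_mul_eq, inv_mul_eq_iff_eq_mul, huv]
    rw [this, mul_assoc]

end RankThree

/-! ### Dual generators in the Artin group of type `H₃` -/

section ArtinH3

variable {G : Type*} [Group G] {a b c : G}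

/-- Three elements satisfying the braid relations of type `H₃`. -/
structure IsH3Triple (a b c : G) : Prop where
  ab : a * b * a = b * a * b
  ac : a * c = c * a
  bc : b * c * b * c * b = c * b * c * b * c

/-- The dual generators: the conjugates of `a`, `b`, `c` by the powers of the Coxeter element
`a c b`. The dual generator `(i, k)` is the conjugate of the `i`-th element by the `k`-th power. -/
def dualGen (a b c : G) (i : Fin 3) (k : ℕ) : G :=
  (a * c * b) ^ k * ![a, b, c] i * ((a * c * b) ^ k)⁻¹

namespace IsH3Triple

theorem conj_a (h : IsH3Triple a b c) : (a * c * b) * a * (a * c * b)⁻¹ = c * b * c⁻¹ := by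
  have h1 : a * b * a * b⁻¹ * a⁻¹ = b := by rw [h.ab]; group
  calc a * c * b * a * (a * c * b)⁻¹ = (a * c) * b * a * b⁻¹ * (a * c)⁻¹ := by group
    _ = c * (a * b * a * b⁻¹ * a⁻¹) * c⁻¹ := by rw [h.ac]; group
    _ = c * b * c⁻¹ := by rw [h1]

theorem conj_inv_a (h : IsH3Triple a b c) : (a * c * b)⁻¹ * a * (a * c * b) = b⁻¹ * a * b := by
  calc (a * c * b)⁻¹ * a * (a * c * b) = b⁻¹ * (c⁻¹ * (a * c)) * b := by group
    _ = b⁻¹ * a * b := by rw [h.ac]; group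

theorem conj_inv_c (h : IsH3Triple a b c) : (a * c * b)⁻¹ * c * (a * c * b) = b⁻¹ * c * b := by
  calc (a * c * b)⁻¹ * c * (a * c * b) = b⁻¹ * ((a * c)⁻¹ * (c * a) * c) * b := by group
    _ = b⁻¹ * c * b := by rw [← h.ac]; group

/-- The element `c b c b⁻¹ c⁻¹ = b⁻¹ c⁻¹ b c b` of the dihedral part is both the third conjugate
of `a` by the Coxeter element, and its second conjugate by the inverse. -/
theorem conj_cbc (h : IsH3Triple a b c) : (a * c * b) ^ 2 * (c * b * c⁻¹) * ((a * c * b) ^ 2)⁻¹ =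
    c * b * c * b⁻¹ * c⁻¹ := by
  have h1 : b⁻¹ * a * b = a * b * a⁻¹ := by
    rw [eq_mul_inv_iff_mul_eq, mul_assoc, mul_assoc, inv_mul_eq_iff_eq_mul, ← mul_assoc, h.ab,
      mul_assoc]
  have h2 : c * b * c * b * c⁻¹ = b⁻¹ * c * b * c * b := by
    calc c * b * c * b * c⁻¹ = b⁻¹ * (b * c * b * c * b) * c⁻¹ := by group
      _ = b⁻¹ * c * b * c * b := by rw [h.bc]; group
  have h4 : c⁻¹ * (a * c) = a := by rw [h.ac, inv_mul_cancel_left]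
  have h3 : a * b * a * b⁻¹ = b * a := by rw [h.ab]; group
  rw [mul_inv_eq_iff_eq_mul]
  calc (a * c * b) ^ 2 * (c * b * c⁻¹) = a * c * b * a * (c * b * c * b * c⁻¹) := by
        rw [pow_two]; group
    _ = c * (a * b * a * b⁻¹) * c * b * c * b := by rw [h2, h.ac]; group
    _ = c * b * (a * c) * b * c * b := by rw [h3]; group
    _ = c * b * (c * a) * b * c * b := by rw [h.ac]
    _ = c * b * c * (a * b * a⁻¹) * (a * c) * b := by group
    _ = c * b * c * b⁻¹ * (c⁻¹ * (a * c)) * b * (a * c) * b := by rw [← h1, h4]; group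
    _ = c * b * c * b⁻¹ * c⁻¹ * (a * c * b) ^ 2 := by rw [pow_two]; group

theorem conj_inv_sq_a (h : IsH3Triple a b c) : ((a * c * b) ^ 2)⁻¹ * a * (a * c * b) ^ 2 =
    b⁻¹ * c⁻¹ * b * c * b := by
  have h1 : a⁻¹ * b⁻¹ * a * b * a = b := by
    rw [mul_assoc, mul_assoc, ← mul_assoc a, h.ab]; group
  calc ((a * c * b) ^ 2)⁻¹ * a * (a * c * b) ^ 2 =
        (a * c * b)⁻¹ * ((a * c * b)⁻¹ * a * (a * c * b)) * (a * c * b) := by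
          rw [pow_two]; group
    _ = b⁻¹ * (a * c)⁻¹ * b⁻¹ * a * b * (a * c) * b := by rw [h.conj_inv_a]; group
    _ = b⁻¹ * c⁻¹ * (a⁻¹ * b⁻¹ * a * b * a) * c * b := by group
    _ = b⁻¹ * c⁻¹ * b * c * b := by rw [h1]

theorem dihedral_eq (h : IsH3Triple a b c) :
    b⁻¹ * c⁻¹ * b * c * b = c * b * c * b⁻¹ * c⁻¹ := by
  rw [eq_mul_inv_iff_mul_eq, eq_mul_inv_iff_mul_eq]
  have := h.bc
  calc b⁻¹ * c⁻¹ * b * c * b * c * b = b⁻¹ * c⁻¹ * (b * c * b * c * b) := by group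
    _ = c * b * c := by rw [h.bc]; group

/-- The fifth power of the Coxeter element is central. -/
theorem commute_pow_five (h : IsH3Triple a b c) :
    Commute ((a * c * b) ^ 5) a ∧ Commute ((a * c * b) ^ 5) b ∧ Commute ((a * c * b) ^ 5) c := by
  set C := a * c * b with hC
  have ha : Commute (C ^ 5) a := by
    have h1 : C ^ 2 * (C * a * C⁻¹) * (C ^ 2)⁻¹ = (C ^ 2)⁻¹ * a * C ^ 2 := by
      rw [h.conj_a, h.conj_cbc, h.conj_inv_sq_a, h.dihedral_eq]
    calc C ^ 5 * a = C ^ 2 * (C ^ 2 * (C * a * C⁻¹) * (C ^ 2)⁻¹) * C ^ 3 := by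
          simp only [pow_succ, pow_zero]; group
      _ = a * C ^ 5 := by rw [h1]; simp only [pow_succ, pow_zero]; group
  have hC1 : Commute (C ^ 5) C := (Commute.refl C).pow_left 5
  have hx : Commute (C ^ 5) (C⁻¹ * a * C) := (hC1.inv_right.mul_right ha).mul_right hC1
  have hb : Commute (C ^ 5) b := by
    have : b = a⁻¹ * (C⁻¹ * a * C) * a := by
      rw [h.conj_inv_a, mul_assoc, mul_assoc, mul_assoc, ← mul_assoc a, h.ab]
      group
    rw [this]
    exact (ha.inv_right.mul_right hx).mul_right ha
  have hc : a⁻¹ * C * b⁻¹ = c := by rw [hC]; group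
  exact ⟨ha, hb, hc ▸ (ha.inv_right.mul_right hC1).mul_right hb.inv_right⟩

theorem dualGen_add_five (h : IsH3Triple a b c) (i : Fin 3) (k : ℕ) :
    dualGen a b c i (k + 5) = dualGen a b c i k := by
  have hi : Commute ((a * c * b) ^ 5) (![a, b, c] i) := by
    obtain ⟨ha, hb, hc⟩ := h.commute_pow_five
    fin_cases i
    exacts [ha, hb, hc]
  rw [dualGen, dualGen, pow_add, mul_assoc _ (_ ^ 5), hi.eq]
  group

theorem dualGen_mod_five (h : IsH3Triple a b c) (i : Fin 3) (k : ℕ) :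
    dualGen a b c i (k % 5) = dualGen a b c i k := by
  have key (q r : ℕ) : dualGen a b c i (r + 5 * q) = dualGen a b c i r := by
    induction q with
    | zero => rfl
    | succ q ih => rw [Nat.mul_succ, ← add_assoc, h.dualGen_add_five, ih]
  conv_rhs => rw [← Nat.mod_add_div k 5]
  exact (key _ _).symm

end IsH3Triple

theorem dualGen_add (i : Fin 3) (n k : ℕ) : dualGen a b c i (k + n) =
    (a * c * b) ^ n * dualGen a b c i k * ((a * c * b) ^ n)⁻¹ := by
  rw [dualGen, dualGen, add_comm, pow_add]
  group

/-- A factorization of the Coxeter element into three dual generators can be normalized, by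
conjugation with the Coxeter element, to have first factor `a`, `b` or `c`. -/
theorem IsH3Triple.dualGen_mul_eq_iff (h : IsH3Triple a b c) (i j m : Fin 3) {k : ℕ} (l n : ℕ)
    (hk : k < 5) :
    dualGen a b c i k * dualGen a b c j l * dualGen a b c m n = a * c * b ↔
      dualGen a b c i 0 * dualGen a b c j ((l + (5 - k)) % 5) *
        dualGen a b c m ((n + (5 - k)) % 5) = a * c * b := by
  have h0 : dualGen a b c i 0 = dualGen a b c i (k + (5 - k)) := by
    rw [← h.dualGen_mod_five i (k + (5 - k)), Nat.add_sub_cancel' hk.le]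
  rw [h0, h.dualGen_mod_five, h.dualGen_mod_five, dualGen_add i, dualGen_add j, dualGen_add m]
  set D := (a * c * b) ^ (5 - k) with hD
  have hDC : D * (a * c * b) * D⁻¹ = a * c * b := by
    rw [mul_inv_eq_iff_eq_mul]
    exact (Commute.refl _).pow_left _
  rw [show ∀ x y z : G, D * x * D⁻¹ * (D * y * D⁻¹) * (D * z * D⁻¹) = D * (x * y * z) * D⁻¹ by
    intro x y z; group]
  constructor
  · intro e
    rw [e, hDC]
  · intro e
    rw [← hDC] at e
    exact mul_left_cancel (mul_right_cancel e)

/-- The ten factorizations of the Coxeter element into dual generators `(i, k)` whose first factor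
is `a`, `b` or `c`; all others are conjugate to these under the Coxeter element. -/
def dualFactorizations : List (Fin 3 × (Fin 3 × ℕ) × (Fin 3 × ℕ)) :=
  [(0, (0, 1), (2, 0)), (0, (0, 3), (0, 1)), (0, (1, 0), (2, 4)), (0, (2, 0), (1, 0)),
    (0, (2, 4), (0, 3)), (1, (0, 4), (2, 4)), (1, (2, 4), (0, 4)), (2, (0, 0), (1, 0)),
    (2, (1, 0), (0, 4)), (2, (0, 4), (0, 0))]

/-- The ten factorizations hold in every group, hence also in the Artin group. -/
theorem IsH3Triple.dualGen_mul_of_mem (h : IsH3Triple a b c)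
    {p : Fin 3 × (Fin 3 × ℕ) × (Fin 3 × ℕ)} (hp : p ∈ dualFactorizations) :
    dualGen a b c p.1 0 * dualGen a b c p.2.1.1 p.2.1.2 * dualGen a b c p.2.2.1 p.2.2.2 =
      a * c * b := by
  have g0 : dualGen a b c 0 0 = a := by simp [dualGen]
  have g1 : dualGen a b c 1 0 = b := by simp [dualGen]
  have g2 : dualGen a b c 2 0 = c := by simp [dualGen]
  have g01 : dualGen a b c 0 1 = c * b * c⁻¹ := by rw [← h.conj_a]; simp [dualGen]
  have g03 : dualGen a b c 0 3 = c * b * c * b⁻¹ * c⁻¹ := by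
    rw [dualGen_add 0 2 1, g01, h.conj_cbc]
  have inv (i : Fin 3) : dualGen a b c i 4 = (a * c * b)⁻¹ * ![a, b, c] i * (a * c * b) := by
    have h5 := h.dualGen_add_five i 0
    rw [dualGen_add i 1 4, pow_one, mul_inv_eq_iff_eq_mul, ← eq_inv_mul_iff_mul_eq] at h5
    rw [h5, ← mul_assoc]
    simp [dualGen]
  have g04 : dualGen a b c 0 4 = b⁻¹ * a * b := (inv 0).trans h.conj_inv_a
  have g24 : dualGen a b c 2 4 = b⁻¹ * c * b := (inv 2).trans h.conj_inv_c
  simp only [dualFactorizations, List.mem_cons, List.not_mem_nil, or_false] at hp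
  have hac := h.ac
  rcases hp with rfl | rfl | rfl | rfl | rfl | rfl | rfl | rfl | rfl | rfl <;>
    simp only [g0, g1, g2, g01, g03, g04, g24]
  · group
  · group
  · group
  · rw [← h.dihedral_eq]; group
  · rw [show b * (b⁻¹ * a * b) * (b⁻¹ * c * b) = a * c * b by group]
  · rw [show b * (b⁻¹ * c * b) * (b⁻¹ * a * b) = c * a * b by group, hac]
  · rw [hac]
  · rw [hac]; group
  · calc c * (b⁻¹ * a * b) * a = c * b⁻¹ * (a * b * a) := by group
      _ = a * c * b := by rw [h.ab, hac]; group

end ArtinH3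

/-! ### The interval group and the Artin group of type `H₃` -/

section ArtinComparison

theorem map_altProd {G H : Type*} [Group G] [Group H] (f : G →* H) (a b : G) (m : ℕ) :
    f (altProd a b m) = altProd (f a) (f b) m := by
  induction m generalizing a b with
  | zero => exact map_one f
  | succ m ih => rw [altProd, altProd, map_mul, ih]

theorem map_dualGen {G H : Type*} [Group G] [Group H] (f : G →* H) (a b c : G) (i : Fin 3)
    (k : ℕ) : f (dualGen a b c i k) = dualGen (f a) (f b) (f c) i k := by
  simp only [dualGen, map_mul, map_inv, map_pow]
  congr 2
  fin_cases i <;> rfl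

theorem isH3Triple_artinGroup : IsH3Triple (PresentedGroup.of 0 : ArtinGroup CoxeterMatrix.H₃)
    (PresentedGroup.of 1) (PresentedGroup.of 2) := by
  have key (i j : Fin 3) : altProd (PresentedGroup.of i : ArtinGroup CoxeterMatrix.H₃)
      (PresentedGroup.of j) (CoxeterMatrix.H₃ i j) =
      altProd (PresentedGroup.of j) (PresentedGroup.of i) (CoxeterMatrix.H₃ i j) := by
    have h := PresentedGroup.one_of_mem (rels := artinRelators CoxeterMatrix.H₃) ⟨i, j, rfl⟩
    rwa [map_mul, map_inv, mul_inv_eq_one, map_altProd, map_altProd] at h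
  have h01 := key 0 1
  have h02 := key 0 2
  have h12 := key 1 2
  rw [show CoxeterMatrix.H₃ 0 1 = 3 from rfl] at h01
  rw [show CoxeterMatrix.H₃ 0 2 = 2 from rfl] at h02
  rw [show CoxeterMatrix.H₃ 1 2 = 5 from rfl] at h12
  simp only [altProd, mul_one] at h01 h02 h12
  exact ⟨by rw [mul_assoc, h01, mul_assoc], h02, by simpa only [mul_assoc] using h12⟩

theorem IsH3Triple.exists_artinGroup_hom {G : Type*} [Group G] {a b c : G}
    (h : IsH3Triple a b c) : ∃ φ : ArtinGroup CoxeterMatrix.H₃ →* G,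
      φ (PresentedGroup.of 0) = a ∧ φ (PresentedGroup.of 1) = b ∧ φ (PresentedGroup.of 2) = c := by
  have hrel : ∀ r ∈ artinRelators CoxeterMatrix.H₃, FreeGroup.lift ![a, b, c] r = 1 := by
    have hab := h.ab
    have hac := h.ac
    have hbc := h.bc
    simp only [mul_assoc] at hab hac hbc
    rintro _ ⟨i, j, rfl⟩
    rw [map_mul, map_inv, mul_inv_eq_one]
    fin_cases i <;> fin_cases j <;>
      simp [altProd, CoxeterMatrix.H₃, hab, hac, hbc]
  exact ⟨PresentedGroup.toGroup hrel, PresentedGroup.toGroup.of hrel,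
    PresentedGroup.toGroup.of hrel, PresentedGroup.toGroup.of hrel⟩

variable {B W : Type*} [Group W] {M : CoxeterMatrix B} (cs : CoxeterSystem M W) {w : W}

open Classical in
/-- The generator of the interval group attached to an element of `[1, w]`, extended by `1` to the
whole group. -/
noncomputable def IntervalGroup.gen (w x : W) : IntervalGroup cs w :=
  if h : AbsLE cs x w then PresentedGroup.of ⟨x, h⟩ else 1

theorem IntervalGroup.gen_of_absLE {x : W} (h : AbsLE cs x w) :
    IntervalGroup.gen cs w x = PresentedGroup.of ⟨x, h⟩ := dif_pos h

theorem IntervalGroup.gen_mul_gen {x y : W} (h : AbsLE cs x (x * y)) (h' : AbsLE cs (x * y) w) :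
    IntervalGroup.gen cs w x * IntervalGroup.gen cs w y = IntervalGroup.gen cs w (x * y) := by
  have hy : AbsLE cs y w := by
    have := (h.inv_mul cs).trans cs h'
    rwa [inv_mul_cancel_left] at this
  rw [gen_of_absLE cs (h.trans cs h'), gen_of_absLE cs hy, gen_of_absLE cs h']
  exact IntervalGroup.of_mul_of cs rfl h

/-- The interval group is generated by the reflections in the interval. -/
theorem IntervalGroup.hom_ext_reflection {G : Type*} [Group G] {f g : IntervalGroup cs w →* G}
    (h : ∀ t : Interval cs w, cs.IsReflection t.1 →
      f (PresentedGroup.of t) = g (PresentedGroup.of t)) : f = g := by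
  refine PresentedGroup.ext fun x => ?_
  induction hn : reflectionLength cs x.1 generalizing x with
  | zero =>
    rw [IntervalGroup.of_eq_one cs ((reflectionLength_eq_zero cs).1 hn), map_one, map_one]
  | succ n ih =>
    obtain ⟨l, hl, hlen⟩ := exists_reduced_isReflectionWord cs x.1
    rw [hn] at hlen
    obtain ⟨t, l, rfl⟩ := List.exists_cons_of_length_eq_add_one hlen
    have ht : cs.IsReflection t := hl.1 t (by simp)
    have hx : t * l.prod = x.1 := by simpa using hl.2
    have hl' : reflectionLength cs l.prod ≤ n := by
      have := reflectionLength_le cs (l := l) (w := l.prod)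
        ⟨fun u hu => hl.1 u (List.mem_cons_of_mem _ hu), rfl⟩
      simpa using this.trans (by simpa using hlen.le)
    have ht1 := (reflectionLength_eq_one cs).2 ht
    have hsub := reflectionLength_mul_le cs t l.prod
    rw [hx, hn, ht1] at hsub
    have htx : AbsLE cs t x.1 := by
      rw [← hx, absLE_mul_iff, hx, hn, ht1]
      omega
    have hlx : AbsLE cs l.prod x.1 := by
      have := htx.inv_mul cs
      rwa [← hx, inv_mul_cancel_left, hx] at this
    let t' : Interval cs w := ⟨t, htx.trans cs x.2⟩
    let y : Interval cs w := ⟨l.prod, hlx.trans cs x.2⟩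
    rw [← IntervalGroup.of_mul_of cs (u := t') (v := y) hx htx, map_mul, map_mul, h t' ht,
      ih y (by change reflectionLength cs l.prod = n; omega)]

variable {a b c : W}

/-- The relations `[t] [u] = [u] [u⁻¹ t u]` of the interval group yield the braid relations between
the three reflections of a factorization of `w`. -/
theorem isH3Triple_gen (h : IsH3Triple a b c) (ha : cs.IsReflection a) (hb : cs.IsReflection b)
    (hc : cs.IsReflection c) (hw : a * c * b = w) (hlen : reflectionLength cs w = 3) :
    IsH3Triple (IntervalGroup.gen cs w a) (IntervalGroup.gen cs w b)
      (IntervalGroup.gen cs w c) := by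
  have two {t u v : W} (ht : cs.IsReflection t) (hu : cs.IsReflection u)
      (hv : cs.IsReflection v) (htuv : t * (u * v) = w) :
      AbsLE cs (u * v) w ∧ reflectionLength cs (u * v) = 2 := by
    have h1 := reflectionLength_mul_le cs t (u * v)
    have h2 := reflectionLength_mul_le cs u v
    rw [htuv, hlen] at h1
    rw [← reflectionLength_eq_one] at ht hu hv
    have h3 : reflectionLength cs (u * v) = 2 := by omega
    refine ⟨?_, h3⟩
    rw [← htuv, absLE_mul_right_iff, absLE_mul_iff, htuv, hlen, ht, h3]
  have hab := two hc ha hb (by rw [← hw, ← mul_assoc, h.ac])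
  have hac := two (hb.conj (a * c)) ha hc (by rw [← hw]; group)
  have hcb := two ha hc hb (by rw [← hw, mul_assoc])
  have rel {r t u : W} (hr : AbsLE cs r w ∧ reflectionLength cs r = 2) (ht : cs.IsReflection t)
      (hu : cs.IsReflection u) (htu : t * u = r) :
      IntervalGroup.gen cs w t * IntervalGroup.gen cs w u = IntervalGroup.gen cs w r := by
    rw [← htu] at hr ⊢
    refine IntervalGroup.gen_mul_gen cs ?_ hr.1
    rw [absLE_mul_iff, hr.2, (reflectionLength_eq_one cs).2 ht, (reflectionLength_eq_one cs).2 hu]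
  have conj {t : W} (ht : cs.IsReflection t) (u : W) : cs.IsReflection (u⁻¹ * t * u) := by
    simpa using ht.conj u⁻¹
  refine ⟨?_, ?_, ?_⟩
  · have h1 := rel hab ha hb rfl
    have h2 := rel hab hb (conj ha b) (by group)
    have h3 := rel hab (conj ha b) ha (by rw [mul_assoc, mul_assoc, ← mul_assoc a, h.ab]; group)
    rw [h1, ← h2, mul_assoc, h3, mul_assoc, h1]
  · rw [rel hac ha hc rfl, rel hac hc ha h.ac.symm]
  · set x := b⁻¹ * c * b
    have hx : cs.IsReflection x := conj hc b
    set y := x⁻¹ * b * x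
    have hy : cs.IsReflection y := conj hb x
    have hz : cs.IsReflection (c * b * c⁻¹) := hb.conj c
    have h1 := rel hcb hc hb rfl
    have h2 := rel hcb hb hx (by simp only [x]; group)
    have h3 := rel hcb hx hy (by simp only [x, y]; group)
    have h4 := rel hcb hy hz (by
      calc y * (c * b * c⁻¹) = b⁻¹ * c⁻¹ * (b * c * b * c * b) * c⁻¹ := by
            simp only [x, y]; group
        _ = c * b := by rw [h.bc]; group)
    have h5 := rel hcb hz hc (by group)
    have h6 := h2.trans h1.symm
    have h7 := h3.trans h1.symm
    have h8 := h4.trans h1.symm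
    have h9 := h5.trans h1.symm
    generalize IntervalGroup.gen cs w x = gx at *
    generalize IntervalGroup.gen cs w y = gy at *
    generalize IntervalGroup.gen cs w (c * b * c⁻¹) = gz at *
    generalize IntervalGroup.gen cs w b = gb at *
    generalize IntervalGroup.gen cs w c = gc at *
    symm
    calc gc * gb * gc * gb * gc = (gc * gb) * (gc * gb) * gc := by group
      _ = (gb * gx) * (gy * gz) * gc := by rw [h6, h8]
      _ = gb * (gx * gy) * (gz * gc) := by group
      _ = gb * gc * gb * gc * gb := by rw [h7, h9]; group

theorem IntervalGroup.gen_conj {x : W} (hx : AbsLE cs x w) :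
    IntervalGroup.gen cs w (w * x * w⁻¹) =
      IntervalGroup.gen cs w w * IntervalGroup.gen cs w x * (IntervalGroup.gen cs w w)⁻¹ := by
  have h1 := IntervalGroup.gen_mul_gen cs (x := w * x * w⁻¹) (y := w * x⁻¹) (w := w)
    (by simpa [mul_assoc] using hx.conj cs w) (by simp)
  have h2 := IntervalGroup.gen_mul_gen cs (x := w * x⁻¹) (y := x) (w := w)
    (by simpa using hx.mul_inv cs) (by simp)
  rw [show w * x * w⁻¹ * (w * x⁻¹) = w by group] at h1
  rw [inv_mul_cancel_right] at h2
  rw [eq_mul_inv_iff_mul_eq, ← h1, mul_assoc _ _ (IntervalGroup.gen cs w x), h2, h1]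

theorem IntervalGroup.gen_dualGen (ha : cs.IsReflection a)
    (hb : cs.IsReflection b) (hc : cs.IsReflection c) (hw : a * c * b = w)
    (hlen : reflectionLength cs w = 3) (hle : ∀ t : W, cs.IsReflection t → AbsLE cs t w)
    (i : Fin 3) (k : ℕ) : IntervalGroup.gen cs w (dualGen a b c i k) =
      dualGen (IntervalGroup.gen cs w a) (IntervalGroup.gen cs w b) (IntervalGroup.gen cs w c)
        i k := by
  have hr : cs.IsReflection (![a, b, c] i) := by
    fin_cases i
    exacts [ha, hb, hc]
  have hC : IntervalGroup.gen cs w a * IntervalGroup.gen cs w c * IntervalGroup.gen cs w b =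
      IntervalGroup.gen cs w w := by
    have hcb : AbsLE cs a w := hle a ha
    have h1 : a * (c * b) = w := by rw [← hw, mul_assoc]
    have h2 : AbsLE cs (c * b) w := by
      have := hcb.inv_mul cs
      rwa [← h1, inv_mul_cancel_left, h1] at this
    have h3 : AbsLE cs c (c * b) := by
      have e1 := reflectionLength_mul_le cs c b
      have e2 := reflectionLength_mul_le cs a (c * b)
      rw [h1, hlen] at e2
      rw [← reflectionLength_eq_one] at ha hb hc
      rw [absLE_mul_iff]
      omega
    rw [mul_assoc, IntervalGroup.gen_mul_gen cs h3 h2, IntervalGroup.gen_mul_gen cs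
      (by rwa [h1]) (by rw [h1]; exact absLE_refl cs w), h1]
  induction k with
  | zero =>
    simp only [dualGen, pow_zero, one_mul, inv_one, mul_one]
    fin_cases i <;> rfl
  | succ k ih =>
    have hk : cs.IsReflection (dualGen a b c i k) := hr.conj _
    rw [dualGen_add i 1 k, dualGen_add i 1 k, pow_one, pow_one, hw, hC, ← ih,
      IntervalGroup.gen_conj cs (hle _ hk)]

/-- If the dual generators of a triple of reflections enumerate all reflections, and satisfy in `W`
only those relations of length three which hold in every group, then the interval group is the
Artin group of type `H₃`. -/
theorem nonempty_intervalGroup_mulEquiv_artinGroup (h : IsH3Triple a b c)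
    (ha : cs.IsReflection a) (hb : cs.IsReflection b) (hc : cs.IsReflection c)
    (hw : a * c * b = w) (hlen : reflectionLength cs w = 3)
    (hle : ∀ t : W, cs.IsReflection t → AbsLE cs t w)
    (hsurj : ∀ t : W, cs.IsReflection t → ∃ i, ∃ k < 5, dualGen a b c i k = t)
    (hinj : ∀ i, ∀ k < 5, ∀ j, ∀ l < 5, dualGen a b c i k = dualGen a b c j l → i = j ∧ k = l)
    (hfac : ∀ i j, ∀ l < 5, ∀ m, ∀ n < 5,
      dualGen a b c i 0 * dualGen a b c j l * dualGen a b c m n = w →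
        (i, (j, l), (m, n)) ∈ dualFactorizations) :
    Nonempty (IntervalGroup cs w ≃* ArtinGroup CoxeterMatrix.H₃) := by
  have hA := isH3Triple_artinGroup
  have hG := isH3Triple_gen cs h ha hb hc hw hlen
  obtain ⟨ψ, hψa, hψb, hψc⟩ := hG.exists_artinGroup_hom
  generalize hA0 : (PresentedGroup.of 0 : ArtinGroup CoxeterMatrix.H₃) = A₀ at *
  generalize hA1 : (PresentedGroup.of 1 : ArtinGroup CoxeterMatrix.H₃) = A₁ at *
  generalize hA2 : (PresentedGroup.of 2 : ArtinGroup CoxeterMatrix.H₃) = A₂ at *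
  choose! i k hk hik using hsurj
  let τ : W → ArtinGroup CoxeterMatrix.H₃ := fun t => dualGen A₀ A₁ A₂ (i t) (k t)
  have hτ_mul : ∀ t u v : W, cs.IsReflection t → cs.IsReflection u → cs.IsReflection v →
      t * u * v = w → τ t * τ u * τ v = A₀ * A₂ * A₁ := by
    intro t u v ht hu hv htuv
    rw [← hik t ht, ← hik u hu, ← hik v hv, ← hw,
      h.dualGen_mul_eq_iff _ _ _ _ _ (hk t ht), hw] at htuv
    refine (hA.dualGen_mul_eq_iff _ _ _ _ _ (hk t ht)).2 ?_
    exact hA.dualGen_mul_of_mem (hfac _ _ _ (Nat.mod_lt _ (by norm_num)) _ _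
      (Nat.mod_lt _ (by norm_num)) htuv)
  obtain ⟨φ, hφ⟩ := exists_intervalGroup_hom cs hlen hle τ (A₀ * A₂ * A₁) hτ_mul
  have hτ (j : Fin 3) (hr : cs.IsReflection (![a, b, c] j)) :
      τ (![a, b, c] j) = ![A₀, A₁, A₂] j := by
    have h0 : dualGen a b c j 0 = ![a, b, c] j := by simp [dualGen]
    obtain ⟨h1, h2⟩ := hinj _ _ (hk _ hr) j 0 (by norm_num) ((hik _ hr).trans h0.symm)
    simp only [τ, h1, h2, dualGen, pow_zero, one_mul, inv_one, mul_one]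
  have hφg (t : W) (ht : cs.IsReflection t) : φ (IntervalGroup.gen cs w t) = τ t := by
    exact (congrArg φ (IntervalGroup.gen_of_absLE cs (hle t ht))).trans (hφ ⟨t, hle t ht⟩ ht)
  refine ⟨MonoidHom.toMulEquiv φ ψ ?_ ?_⟩
  · refine IntervalGroup.hom_ext_reflection cs fun t ht => ?_
    rw [MonoidHom.comp_apply, hφ t ht, MonoidHom.id_apply, map_dualGen, hψa, hψb, hψc,
      ← IntervalGroup.gen_dualGen cs ha hb hc hw hlen hle, hik t.1 ht,
      IntervalGroup.gen_of_absLE cs t.2]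
    rfl
  · have hj (j : Fin 3) : φ (ψ (![A₀, A₁, A₂] j)) = ![A₀, A₁, A₂] j := by
      fin_cases j
      · exact (congrArg φ hψa).trans ((hφg a ha).trans (hτ 0 ha))
      · exact (congrArg φ hψb).trans ((hφg b hb).trans (hτ 1 hb))
      · exact (congrArg φ hψc).trans ((hφg c hc).trans (hτ 2 hc))
    refine PresentedGroup.ext fun j => ?_
    have hj' : (PresentedGroup.of j : ArtinGroup CoxeterMatrix.H₃) = ![A₀, A₁, A₂] j := by
      fin_cases j
      exacts [hA0, hA1, hA2]
    rw [MonoidHom.comp_apply, hj', hj j, MonoidHom.id_apply]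

end ArtinComparison

/-! ### Enumeration of the Coxeter group of type `H₃` -/

section CosetEnumeration

variable {G : Type*} [Group G]

/-- Representatives `x` of the cosets `⟨b, c⟩ x` of the dihedral subgroup, as words in which `0`,
`1`, `2` stand for `a`, `b`, `c`. -/
def cosetWords : List (List (Fin 3)) :=
  [[], [0], [0, 1], [0, 1, 2], [0, 1, 2, 1], [0, 1, 2, 1, 0], [0, 1, 2, 1, 2],
    [0, 1, 2, 1, 0, 2], [0, 1, 2, 1, 0, 2, 1], [0, 1, 2, 1, 0, 2, 1, 2],
    [0, 1, 2, 1, 0, 2, 1, 2, 1], [0, 1, 2, 1, 0, 2, 1, 2, 1, 0]]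

/-- The elements of the dihedral subgroup `⟨b, c⟩`. -/
def dihedralWords : List (List (Fin 3)) :=
  [[], [1], [1, 2], [1, 2, 1], [1, 2, 1, 2], [1, 2, 1, 2, 1], [1, 2, 1, 2, 1, 2],
    [1, 2, 1, 2, 1, 2, 1], [1, 2, 1, 2, 1, 2, 1, 2], [1, 2, 1, 2, 1, 2, 1, 2, 1]]

/-- Words for all elements of the Coxeter group of type `H₃`. -/
def h3Words : List (List (Fin 3)) :=
  dihedralWords.flatMap fun y => cosetWords.map fun x => y ++ x

/-- The products of a coset representative and a generator which neither extend the word to another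
representative nor cancel its last letter: `(x, i, y, x')` stands for `x * i = y * x'`. -/
def cosetTable : List (List (Fin 3) × Fin 3 × List (Fin 3) × List (Fin 3)) :=
  [([], 1, [1], []), ([], 2, [2], []), ([0], 2, [2], [0]), ([0, 1], 0, [1], [0, 1]),
    ([0, 1, 2], 0, [1], [0, 1, 2]), ([0, 1, 2, 1, 0], 1, [1], [0, 1, 2, 1, 0]),
    ([0, 1, 2, 1, 2], 1, [2], [0, 1, 2, 1, 2]), ([0, 1, 2, 1, 2], 0, [], [0, 1, 2, 1, 0, 2]),
    ([0, 1, 2, 1, 0, 2], 0, [], [0, 1, 2, 1, 2]),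
    ([0, 1, 2, 1, 0, 2, 1], 0, [2], [0, 1, 2, 1, 0, 2, 1]),
    ([0, 1, 2, 1, 0, 2, 1, 2], 0, [2], [0, 1, 2, 1, 0, 2, 1, 2]),
    ([0, 1, 2, 1, 0, 2, 1, 2, 1], 2, [1], [0, 1, 2, 1, 0, 2, 1, 2, 1]),
    ([0, 1, 2, 1, 0, 2, 1, 2, 1, 0], 1, [2], [0, 1, 2, 1, 0, 2, 1, 2, 1, 0]),
    ([0, 1, 2, 1, 0, 2, 1, 2, 1, 0], 2, [1], [0, 1, 2, 1, 0, 2, 1, 2, 1, 0])]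

/-- Coset enumeration over the dihedral subgroup `⟨b, c⟩`: a product of a representative and a
generator is a representative again, or changes only by a left factor `b` or `c`. -/
theorem exists_cosetWord_mul {a b c : G} (h : IsH3Triple a b c) (ha : a * a = 1) (hb : b * b = 1)
    (hc : c * c = 1) {x : List (Fin 3)} (hx : x ∈ cosetWords) (i : Fin 3) :
    ∃ y ∈ [[], [1], [2]], ∃ x' ∈ cosetWords,
      (x.map ![a, b, c]).prod * ![a, b, c] i =
        ((y : List (Fin 3)).map ![a, b, c]).prod * (x'.map ![a, b, c]).prod := by
  have ca (g : G) : g * a * a = g := by rw [mul_assoc, ha, mul_one]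
  have cb (g : G) : g * b * b = g := by rw [mul_assoc, hb, mul_one]
  have cc (g : G) : g * c * c = g := by rw [mul_assoc, hc, mul_one]
  have e1 : a * c = c * a := h.ac
  have hac (g : G) : g * a * c = g * c * a := by rw [mul_assoc, e1, mul_assoc]
  have hab (g : G) : g * b * a * b = g * a * b * a := by
    simp only [mul_assoc]; rw [← mul_assoc b, ← h.ab]; simp only [mul_assoc]
  have hbc (g : G) : g * c * b * c * b * c = g * b * c * b * c * b := by
    have := congrArg (g * ·) h.bc
    simpa only [mul_assoc] using this.symm
  have e2 : a * b * a = b * (a * b) := by rw [h.ab, mul_assoc]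
  have e3 : a * b * c * a = b * (a * b * c) := by rw [← hac, e2]; simp only [mul_assoc]
  have e5 : a * b * c * b * a * b = b * (a * b * c * b * a) := by
    rw [hab, e3]; simp only [mul_assoc]
  have e6 : a * b * c * b * c * b = c * (a * b * c * b * c) := by
    rw [← hbc, e1]; simp only [mul_assoc]
  have e7 : a * b * c * b * a * c = a * b * c * b * c * a := hac _
  have e8 : a * b * c * b * a * c * b * a = c * (a * b * c * b * a * c * b) := by
    rw [e7, ← hab, e6]; simp only [mul_assoc]
  have e9 : a * b * c * b * a * c * b * c * a = c * (a * b * c * b * a * c * b * c) := by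
    rw [← hac, e8]; simp only [mul_assoc]
  have e10 : a * b * c * b * a * c * b * c * b * c =
      b * (a * b * c * b * a * c * b * c * b) := by
    rw [hbc, e5]; simp only [mul_assoc]
  have e11 : a * b * c * b * a * c * b * c * b * a * b =
      c * (a * b * c * b * a * c * b * c * b * a) := by
    rw [hab, e9]; simp only [mul_assoc]
  have e11' : a * b * c * b * a * c * b * c * b * a * c =
      b * (a * b * c * b * a * c * b * c * b * a) := by
    rw [hac, e10]; simp only [mul_assoc]
  have cases : ∀ x ∈ cosetWords, ∀ i, x ++ [i] ∈ cosetWords ∨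
      (∃ x' ∈ cosetWords, x = x' ++ [i]) ∨
      ∃ p ∈ cosetTable, p.1 = x ∧ p.2.1 = i ∧ p.2.2.1 ∈ [[], [1], [2]] ∧ p.2.2.2 ∈ cosetWords := by
    decide +kernel
  rcases cases x hx i with hx' | ⟨x', hx', rfl⟩ | ⟨p, hp, rfl, rfl, hy, hx'⟩
  · exact ⟨[], by simp, _, hx', by simp⟩
  · refine ⟨[], by simp, x', hx', ?_⟩
    have hi : ![a, b, c] i * ![a, b, c] i = 1 := by
      fin_cases i
      exacts [ha, hb, hc]
    simp [mul_assoc, hi]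
  · refine ⟨_, hy, _, hx', ?_⟩
    simp only [cosetTable, List.mem_cons, List.not_mem_nil, or_false] at hp
    rcases hp with rfl | rfl | rfl | rfl | rfl | rfl | rfl | rfl | rfl | rfl | rfl | rfl | rfl | rfl
    · simp
    · simp
    · simpa using e1
    · simpa [mul_assoc] using e2
    · simpa [mul_assoc] using e3
    · simpa [mul_assoc] using e5
    · simpa [mul_assoc] using e6
    · simpa [mul_assoc] using e7.symm
    · simpa [mul_assoc, ha] using congrArg (· * a) e7
    · simpa [mul_assoc] using e8
    · simpa [mul_assoc] using e9
    · simpa [mul_assoc] using e10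
    · simpa [mul_assoc] using e11
    · simpa [mul_assoc] using e11'

/-- Every element of a group generated by three involutions satisfying the braid relations of type
`H₃` is given by one of the `120` words. -/
theorem exists_h3Word {a b c : G} (h : IsH3Triple a b c) (ha : a * a = 1) (hb : b * b = 1)
    (hc : c * c = 1) (w : List (Fin 3)) :
    ∃ l ∈ h3Words, (w.map ![a, b, c]).prod = (l.map ![a, b, c]).prod := by
  have nine : b * c * b * c * b * c * b * c * b = c := by
    calc b * c * b * c * b * c * b * c * b = b * c * b * c * b * (c * b * c * b) := by
          simp only [mul_assoc]
      _ = c * b * c * (b * (c * c) * b) * c * b := by rw [h.bc]; simp only [mul_assoc]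
      _ = c := by
          simp only [hc, hb, mul_one, mul_assoc]
  have dihedral (y : List (Fin 3)) (hy : y ∈ dihedralWords) (z : List (Fin 3))
      (hz : z ∈ [[], [1], [2]]) : ∃ y' ∈ dihedralWords,
      (y.map ![a, b, c]).prod * (z.map ![a, b, c]).prod = (y'.map ![a, b, c]).prod := by
    have cases : ∀ y ∈ dihedralWords, ∀ z ∈ [[], [1], [2]], y ++ z ∈ dihedralWords ∨
        (z ≠ [] ∧ ∃ y' ∈ dihedralWords, y = y' ++ z) ∨
        (y = [] ∧ z = [2]) ∨ (y = [1, 2, 1, 2, 1, 2, 1, 2, 1] ∧ z = [2]) := by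
      decide +kernel
    rcases cases y hy z hz with hyz | ⟨hz', y', hy', rfl⟩ | ⟨rfl, rfl⟩ | ⟨rfl, rfl⟩
    · exact ⟨_, hyz, by simp⟩
    · refine ⟨y', hy', ?_⟩
      simp only [List.mem_cons, List.not_mem_nil, or_false] at hz
      rcases hz with rfl | rfl | rfl
      · exact absurd rfl hz'
      · simp [mul_assoc, hb]
      · simp [mul_assoc, hc]
    · refine ⟨[1, 2, 1, 2, 1, 2, 1, 2, 1], by decide, ?_⟩
      simpa [mul_assoc] using nine.symm
    · refine ⟨[], by decide, ?_⟩
      simpa [mul_assoc, hc] using congrArg (· * c) nine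
  induction w using List.reverseRecOn with
  | nil => exact ⟨[], by decide +kernel, rfl⟩
  | append_singleton w i ih =>
    obtain ⟨l, hl, hw⟩ := ih
    simp only [h3Words, List.mem_flatMap, List.mem_map] at hl
    obtain ⟨y, hy, x, hx, rfl⟩ := hl
    obtain ⟨z, hz, x', hx', e⟩ := exists_cosetWord_mul h ha hb hc hx i
    obtain ⟨y', hy', e'⟩ := dihedral y hy z hz
    refine ⟨y' ++ x', ?_, ?_⟩
    · simp only [h3Words, List.mem_flatMap, List.mem_map]
      exact ⟨y', hy', x', hx', rfl⟩
    · simp only [List.map_append, List.prod_append, List.map_singleton, List.prod_singleton]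
        at hw e ⊢
      rw [hw, mul_assoc, e, ← mul_assoc, e']

end CosetEnumeration

section Codes

/-- The digit at position `i` of the decimal expansion of `n`. -/
def digit (n i : ℕ) : ℕ := n / 10 ^ i % 10

/-- The permutations of `{0, …, 6}` are encoded by natural numbers: the digit at position `i` is
the image of `i`. The identity has code `6543210`. On numerals, products reduce to a few
divisions, so that tables of all `120` elements can be verified by evaluation. -/
def permCode (p : Equiv.Perm (Fin 7)) : ℕ :=
  p 0 + p 1 * 10 + p 2 * 100 + p 3 * 1000 + p 4 * 10000 + p 5 * 100000 + p 6 * 1000000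

/-- The product of permutations, on codes. -/
def codeMul (m n : ℕ) : ℕ :=
  digit m (digit n 0) + digit m (digit n 1) * 10 + digit m (digit n 2) * 100 +
    digit m (digit n 3) * 1000 + digit m (digit n 4) * 10000 + digit m (digit n 5) * 100000 +
    digit m (digit n 6) * 1000000

theorem digit_permCode (p : Equiv.Perm (Fin 7)) (i : Fin 7) : digit (permCode p) i = p i := by
  have h0 := (p 0).isLt
  have h1 := (p 1).isLt
  have h2 := (p 2).isLt
  have h3 := (p 3).isLt
  have h4 := (p 4).isLt
  have h5 := (p 5).isLt
  have h6 := (p 6).isLt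
  unfold digit permCode
  fin_cases i <;> simp <;> omega

theorem permCode_mul (p q : Equiv.Perm (Fin 7)) :
    permCode (p * q) = codeMul (permCode p) (permCode q) := by
  have hq (i : Fin 7) : digit (permCode p) (digit (permCode q) i) = (p * q) i := by
    rw [digit_permCode, digit_permCode, Equiv.Perm.mul_apply]
  have h0 := hq 0
  have h1 := hq 1
  have h2 := hq 2
  have h3 := hq 3
  have h4 := hq 4
  have h5 := hq 5
  have h6 := hq 6
  simp only [Fin.isValue, Fin.coe_ofNat_eq_mod, Nat.zero_mod, Nat.one_mod, Nat.reduceMod]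
    at h0 h1 h2 h3 h4 h5 h6
  rw [codeMul, h0, h1, h2, h3, h4, h5, h6, permCode]

theorem permCode_injective : Function.Injective permCode := fun p q h => by
  ext i
  rw [← digit_permCode, ← digit_permCode, h]

/-- The codes of the simple reflections, in a faithful permutation representation. -/
def simpleCode (i : Fin 3) : ℕ := [5634120, 5634201, 5621430][i]

/-- The code of a word in the simple reflections. -/
def wordCode (l : List (Fin 3)) : ℕ := (l.map simpleCode).foldr codeMul 6543210

/-- The codes of all elements of the Coxeter group of type `H₃`, in the order of `h3Words`. -/
def h3Codes : List ℕ :=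
  [6543210, 5634120, 6543102, 5610432, 6501423, 5610243, 5642013, 6524103, 5642130, 6513420,
   5631402, 6513042, 5634201, 6543021, 5634012, 6501342, 5610324, 6501234, 6532104, 5623014,
   6532041, 5604321, 6540312, 5604132, 6520341, 5602431, 6520413, 5641203, 6514230, 5641320,
   5623140, 6532410, 5623401, 6540231, 5604213, 6540123, 5602314, 6520134, 5602143, 6514023,
   5641032, 6514302, 6503412, 5630142, 6503124, 5612034, 6521043, 5612403, 6531024, 5613204,
   6531240, 5624310, 6542301, 5624031, 5630421, 6503241, 5630214, 6521304, 5612340, 6521430,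
   5613042, 6531402, 5613420, 6542130, 5624103, 6542013, 6510243, 5601423, 6510432, 5643102,
   6534120, 5643210, 6504132, 5640312, 6504321, 5632041, 6523014, 5632104, 5601234, 6510324,
   5601342, 6534012, 5643021, 6534201, 5640123, 6504213, 5640231, 6523401, 5632410, 6523140,
   6541320, 5614230, 6541203, 5620413, 6502431, 5620341, 6512403, 5621043, 6512034, 5603124,
   6530142, 5603412, 5614302, 6541032, 5614023, 6502143, 5620134, 6502314, 5621430, 6512340,
   5621304, 6530214, 5603241, 6530421, 6524031, 5642301, 6524310, 5631240, 6513204, 5631024]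

/-- The codes of the reflections, in the order in which they arise as dual generators of a
factorization of a proper quasi-Coxeter element. -/
def reflectionCodes : List ℕ :=
  [5610243, 5613042, 5641032, 5621430, 5620413, 5640123, 5612340, 5634012, 5601234, 5623401,
   5634201, 5603124, 5642301, 5634120, 5602314]

set_option maxRecDepth 10000 in
theorem map_wordCode : h3Words.map wordCode = h3Codes := by decide +kernel

theorem wordCode_ne_one : ∀ y ∈ dihedralWords, ∀ x ∈ cosetWords,
    wordCode (y ++ x) = 6543210 → y ++ x = [] := by
  decide +kernel

variable {W : Type*} [Group W] (cs : CoxeterSystem CoxeterMatrix.H₃ W)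

/-- An injective encoding of the Coxeter group of type `H₃` by the numbers in `h3Codes`, under which
the reflections correspond to `reflectionCodes`. -/
structure IsH3Coding (F : W → ℕ) : Prop where
  inj : Function.Injective F
  map_one : F 1 = 6543210
  map_mul : ∀ x y, F (x * y) = codeMul (F x) (F y)
  mem : ∀ x, F x ∈ h3Codes
  surj : ∀ n ∈ h3Codes, ∃ x, F x = n
  refl : ∀ t, cs.IsReflection t ↔ F t ∈ reflectionCodes

theorem isH3Triple_simple : IsH3Triple (cs.simple 0) (cs.simple 1) (cs.simple 2) := by
  have h01 := cs.wordProd_braidWord_eq 0 1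
  have h02 := cs.wordProd_braidWord_eq 0 2
  have h12 := cs.wordProd_braidWord_eq 1 2
  simp only [CoxeterSystem.braidWord] at h01 h02 h12
  rw [show CoxeterMatrix.H₃ 0 1 = 3 from rfl, show CoxeterMatrix.H₃ 1 0 = 3 from rfl] at h01
  rw [show CoxeterMatrix.H₃ 0 2 = 2 from rfl, show CoxeterMatrix.H₃ 2 0 = 2 from rfl] at h02
  rw [show CoxeterMatrix.H₃ 1 2 = 5 from rfl, show CoxeterMatrix.H₃ 2 1 = 5 from rfl] at h12
  simp only [CoxeterSystem.alternatingWord, List.concat_eq_append, List.nil_append,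
    List.cons_append, CoxeterSystem.wordProd_cons, CoxeterSystem.wordProd_nil, mul_one]
    at h01 h02 h12
  refine ⟨?_, ?_, ?_⟩
  · simpa only [mul_assoc] using h01.symm
  · exact h02
  · simpa only [mul_assoc] using h12.symm

/-- The images of the simple reflections in a faithful permutation representation: `A₅` acts on
`{0, …, 4}`, and the sign acts on `{5, 6}`. -/
def simplePerm : Fin 3 → Equiv.Perm (Fin 7) :=
  ![Equiv.swap 1 2 * Equiv.swap 3 4 * Equiv.swap 5 6,
    Equiv.swap 0 1 * Equiv.swap 3 4 * Equiv.swap 5 6,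
    Equiv.swap 1 3 * Equiv.swap 2 4 * Equiv.swap 5 6]

theorem permCode_simplePerm : ∀ i, permCode (simplePerm i) = simpleCode i := by decide +kernel

theorem permCode_one : permCode 1 = 6543210 := by decide +kernel

theorem permCode_pow (q : Equiv.Perm (Fin 7)) (m : ℕ) :
    permCode (q ^ m) = (codeMul (permCode q))^[m] 6543210 := by
  induction m with
  | zero => rw [pow_zero, permCode_one, Function.iterate_zero, id]
  | succ m ih => rw [pow_succ', permCode_mul, ih, Function.iterate_succ_apply']

theorem codeMul_simpleCode_pow :
    ∀ i j, (codeMul (codeMul (simpleCode i) (simpleCode j)))^[CoxeterMatrix.H₃ i j] 6543210 =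
      6543210 := by
  decide +kernel

theorem isLiftable_simplePerm : CoxeterMatrix.H₃.IsLiftable simplePerm := by
  intro i j
  refine permCode_injective ?_
  rw [permCode_pow, permCode_mul, permCode_simplePerm, permCode_simplePerm,
    codeMul_simpleCode_pow, permCode_one]

/-- The faithful permutation representation. -/
noncomputable def permRep : W →* Equiv.Perm (Fin 7) := cs.lift ⟨simplePerm, isLiftable_simplePerm⟩

theorem permCode_permRep_wordProd (l : List (Fin 3)) :
    permCode (permRep cs (cs.wordProd l)) = wordCode l := by
  induction l with
  | nil => rw [cs.wordProd_nil, map_one, permCode_one, wordCode, List.map_nil, List.foldr_nil]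
  | cons i l ih =>
    rw [cs.wordProd_cons, map_mul, permCode_mul, ih, permRep, cs.lift_apply_simple,
      permCode_simplePerm, wordCode, wordCode, List.map_cons, List.foldr_cons]

theorem exists_h3Word_wordProd (x : W) : ∃ l ∈ h3Words, x = cs.wordProd l := by
  obtain ⟨l, rfl⟩ := cs.wordProd_surjective x
  have hs : cs.simple = ![cs.simple 0, cs.simple 1, cs.simple 2] := by
    ext i
    fin_cases i <;> rfl
  simp only [CoxeterSystem.wordProd]
  rw [hs]
  exact exists_h3Word (isH3Triple_simple cs) (cs.simple_mul_simple_self 0)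
    (cs.simple_mul_simple_self 1) (cs.simple_mul_simple_self 2) l

/-- A nontrivial element is given by one of the `120` words, and only the empty one has the code of
the identity. -/
theorem permRep_injective : Function.Injective (permRep cs) := by
  rw [injective_iff_map_eq_one]
  intro x hx
  obtain ⟨l, hl, rfl⟩ := exists_h3Word_wordProd cs x
  have hl1 : wordCode l = 6543210 := by
    rw [← permCode_permRep_wordProd cs, hx, permCode_one]
  simp only [h3Words, List.mem_flatMap, List.mem_map] at hl
  obtain ⟨y, hy, z, hz, rfl⟩ := hl
  rw [wordCode_ne_one y hy z hz hl1, cs.wordProd_nil]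

theorem mem_h3Codes_of_mem_reflectionCodes : ∀ n ∈ reflectionCodes, n ∈ h3Codes := by
  decide +kernel

theorem exists_reflectionCode_conj : ∀ n ∈ h3Codes, ∀ i, ∃ t ∈ reflectionCodes,
    codeMul t n = codeMul n (simpleCode i) := by
  decide +kernel

theorem reflectionCode_conj : ∀ t ∈ reflectionCodes, ∃ n ∈ h3Codes, ∃ i,
    codeMul t n = codeMul n (simpleCode i) := by
  decide +kernel

/-- The coding by the faithful permutation representation. -/
theorem exists_isH3Coding :
    ∃ F : W → ℕ, IsH3Coding cs F ∧ ∀ l, F (cs.wordProd l) = wordCode l := by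
  obtain ⟨F, hFdef⟩ : ∃ F : W → ℕ, ∀ x, F x = permCode (permRep cs x) := ⟨_, fun _ => rfl⟩
  have hword (l : List (Fin 3)) : F (cs.wordProd l) = wordCode l := by
    rw [hFdef, permCode_permRep_wordProd]
  have hmem (x : W) : F x ∈ h3Codes := by
    obtain ⟨l, hl, rfl⟩ := exists_h3Word_wordProd cs x
    rw [hword, ← map_wordCode]
    exact List.mem_map_of_mem hl
  have hsurj (n : ℕ) (hn : n ∈ h3Codes) : ∃ x, F x = n := by
    rw [← map_wordCode, List.mem_map] at hn
    obtain ⟨l, -, rfl⟩ := hn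
    exact ⟨cs.wordProd l, hword l⟩
  have hmul (x y : W) : F (x * y) = codeMul (F x) (F y) := by
    rw [hFdef, hFdef, hFdef, map_mul, permCode_mul]
  have hinj : Function.Injective F := by
    intro x y h
    rw [hFdef, hFdef] at h
    exact permRep_injective cs (permCode_injective h)
  have hsc (i) : F (cs.simple i) = simpleCode i := by
    rw [hFdef, permRep, cs.lift_apply_simple, permCode_simplePerm]
  refine ⟨F, ⟨hinj, by rw [hFdef, map_one, permCode_one], hmul, hmem, hsurj, fun t => ?_⟩, hword⟩
  constructor
  · rintro ⟨g, i, rfl⟩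
    obtain ⟨t, ht, e⟩ := exists_reflectionCode_conj _ (hmem g) i
    obtain ⟨u, rfl⟩ := hsurj t (mem_h3Codes_of_mem_reflectionCodes t ht)
    rw [← hsc, ← hmul, ← hmul] at e
    have hu : u = g * cs.simple i * g⁻¹ := eq_mul_inv_of_mul_eq (hinj e)
    exact hu ▸ ht
  · intro ht
    obtain ⟨n, hn, i, e⟩ := reflectionCode_conj _ ht
    obtain ⟨g, rfl⟩ := hsurj n hn
    rw [← hsc, ← hmul, ← hmul] at e
    exact ⟨g, i, eq_mul_inv_of_mul_eq (hinj e)⟩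

variable {cs} in
/-- The composition of a coding with an inner automorphism is a coding. -/
theorem IsH3Coding.conj {F : W → ℕ} (hF : IsH3Coding cs F) (g : W) :
    IsH3Coding cs fun x => F (g * x * g⁻¹) where
  inj x y h := mul_left_cancel (mul_right_cancel (hF.inj h))
  map_one := by simpa using hF.map_one
  map_mul x y := by
    rw [← hF.map_mul]
    congr 1
    group
  mem x := hF.mem _
  surj n hn := by
    obtain ⟨x, rfl⟩ := hF.surj n hn
    exact ⟨g⁻¹ * x * g, by congr 1; group⟩
  refl t := by rw [← hF.refl, cs.isReflection_conj_iff]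

end Codes

/-! ### The proper quasi-Coxeter elements of order ten -/

section CodeTables

/-- The code of a chosen proper quasi-Coxeter element of order `10`. -/
def quasiCode : ℕ := 5604321

/-- The codes of the dual generators `(i, k)` of the chosen factorization of `quasiCode`, for
`k < 5`. -/
def dualCode (i : Fin 3) (k : ℕ) : ℕ := reflectionCodes.getD (5 * i + k) 0

/-- A reflection exchanges `5` and `6`. -/
theorem digit_codeMul_reflectionCode : ∀ t ∈ reflectionCodes, ∀ n ∈ h3Codes,
    digit (codeMul t n) 5 = 5 ↔ ¬ digit n 5 = 5 := by
  decide +kernel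

/-- Every even element other than the identity is a product of two reflections. -/
theorem exists_reflectionCode_mul : ∀ n ∈ h3Codes, digit n 5 = 5 → n ≠ 6543210 →
    ∃ t ∈ reflectionCodes, ∃ u ∈ reflectionCodes, codeMul t u = n := by
  decide +kernel

/-- Two distinct reflections `t`, `t'` lie below at most one element `u * w` of length two. -/
theorem eq_of_common_upper_bounds : ∀ t ∈ reflectionCodes, ∀ t' ∈ reflectionCodes, t ≠ t' →
    ∀ u ∈ reflectionCodes, codeMul (codeMul t u) quasiCode ∈ reflectionCodes →
      codeMul (codeMul t' u) quasiCode ∈ reflectionCodes →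
    ∀ u' ∈ reflectionCodes, codeMul (codeMul t u') quasiCode ∈ reflectionCodes →
      codeMul (codeMul t' u') quasiCode ∈ reflectionCodes → u = u' := by
  decide +kernel

/-- The elements of order `10` form two conjugacy classes, that of the chosen quasi-Coxeter element
and that of the Coxeter elements. -/
theorem conj_of_order_ten : ∀ n ∈ h3Codes, (codeMul n)^[10] 6543210 = 6543210 →
    (codeMul n)^[5] 6543210 ≠ 6543210 → (codeMul n)^[2] 6543210 ≠ 6543210 →
    ∃ g ∈ h3Codes, codeMul g quasiCode = codeMul n g ∨
      codeMul g (wordCode [0, 2, 1]) = codeMul n g := by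
  decide +kernel

theorem coxeterCode_not_conj : ∀ i j k : Fin 3, [i, j, k].Nodup → ∀ g ∈ h3Codes,
    codeMul g (wordCode [i, j, k]) ≠ codeMul quasiCode g := by
  decide +kernel

set_option synthInstance.maxSize 1000 in
/-- In the Coxeter group, the chosen element has no factorization into three reflections besides the
conjugates of those in `dualFactorizations`. -/
theorem dualCode_mul_mem : ∀ i j, ∀ l < 5, ∀ m, ∀ n < 5,
    codeMul (codeMul (dualCode i 0) (dualCode j l)) (dualCode m n) = quasiCode →
      (i, (j, l), (m, n)) ∈ dualFactorizations := by
  decide +kernel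

/-- The codes of the dual generators are permuted by conjugation with the chosen element. -/
theorem dualCode_succ : ∀ i, ∀ k < 4,
    codeMul (dualCode i (k + 1)) quasiCode = codeMul quasiCode (dualCode i k) := by
  decide +kernel

theorem dualCode_injective : ∀ i, ∀ k < 5, ∀ j, ∀ l < 5,
    dualCode i k = dualCode j l → i = j ∧ k = l := by
  decide +kernel

theorem exists_dualCode_eq : ∀ t ∈ reflectionCodes, ∃ i, ∃ k < 5, dualCode i k = t := by
  decide +kernel

theorem dualCode_mem_h3Codes : ∀ i, ∀ k < 5, dualCode i k ∈ h3Codes := by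
  decide +kernel

theorem dualCode_mem : ∀ i, dualCode i 0 ∈ reflectionCodes := by
  decide +kernel

end CodeTables

section QuasiCoxeter

variable {W : Type*} [Group W] {cs : CoxeterSystem CoxeterMatrix.H₃ W} {F : W → ℕ}

namespace IsH3Coding

theorem map_pow (hF : IsH3Coding cs F) (x : W) (n : ℕ) :
    F (x ^ n) = (codeMul (F x))^[n] 6543210 := by
  induction n with
  | zero => rw [pow_zero, hF.map_one, Function.iterate_zero, id]
  | succ n ih => rw [pow_succ', hF.map_mul, ih, Function.iterate_succ_apply']

theorem pow_eq_one_iff (hF : IsH3Coding cs F) (x : W) (n : ℕ) :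
    x ^ n = 1 ↔ (codeMul (F x))^[n] 6543210 = 6543210 := by
  rw [← hF.map_pow, ← hF.inj.eq_iff, hF.map_one]

theorem eq_iff (hF : IsH3Coding cs F) {x y : W} : F x = F y ↔ x = y := hF.inj.eq_iff

/-- The digit at position `5` records the sign of an element. -/
theorem digit_eq_iff_even (hF : IsH3Coding cs F) (x : W) :
    digit (F x) 5 = 5 ↔ Even (reflectionLength cs x) := by
  obtain ⟨l, hl, hlen⟩ := exists_reduced_isReflectionWord cs x
  rw [← hlen]
  clear hlen
  induction l generalizing x with
  | nil =>
    have : x = 1 := by rw [← hl.2, List.prod_nil]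
    rw [this, hF.map_one]
    exact iff_of_true (by decide) (by simp)
  | cons t l ih =>
    have hx : t * l.prod = x := by simpa using hl.2
    have ht : F t ∈ reflectionCodes := (hF.refl t).1 (hl.1 t (by simp))
    rw [← hx, hF.map_mul, digit_codeMul_reflectionCode _ ht _ (hF.mem _),
      ih l.prod ⟨fun u hu => hl.1 u (List.mem_cons_of_mem _ hu), rfl⟩, List.length_cons,
      Nat.even_add_one]

theorem reflectionLength_eq_two (hF : IsH3Coding cs F) {x : W}
    (h : Even (reflectionLength cs x)) (hx : x ≠ 1) : reflectionLength cs x = 2 := by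
  have hx' : F x ≠ 6543210 := by rwa [← hF.map_one, Ne, hF.eq_iff]
  obtain ⟨t, ht, u, hu, e⟩ :=
    exists_reflectionCode_mul _ (hF.mem x) ((hF.digit_eq_iff_even x).2 h) hx'
  obtain ⟨t, rfl⟩ := hF.surj t (mem_h3Codes_of_mem_reflectionCodes _ ht)
  obtain ⟨u, rfl⟩ := hF.surj u (mem_h3Codes_of_mem_reflectionCodes _ hu)
  rw [← hF.map_mul, hF.eq_iff] at e
  have h1 := reflectionLength_mul_le cs t u
  rw [e, (reflectionLength_eq_one cs).2 ((hF.refl t).2 ht),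
    (reflectionLength_eq_one cs).2 ((hF.refl u).2 hu)] at h1
  have h0 : reflectionLength cs x ≠ 0 := mt (reflectionLength_eq_zero cs).1 hx
  obtain ⟨k, hk⟩ := h
  omega

variable {w : W}

/-- The reflections of the chosen factorization of `quasiCode`. -/
theorem exists_factorization (hF : IsH3Coding cs F) (hw : F w = quasiCode) :
    ∃ a b c : W, (∀ i, cs.IsReflection (![a, b, c] i)) ∧ (∀ i, F (![a, b, c] i) = dualCode i 0) ∧
      a * c * b = w := by
  have hsurj (i : Fin 3) : ∃ x, F x = dualCode i 0 :=
    hF.surj _ (mem_h3Codes_of_mem_reflectionCodes _ (dualCode_mem i))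
  choose x hx using hsurj
  have hx' : ∀ i, ![x 0, x 1, x 2] i = x i := by
    intro i
    fin_cases i <;> rfl
  refine ⟨x 0, x 1, x 2, fun i => ?_, fun i => by rw [hx', hx], ?_⟩
  · rw [hx', hF.refl, hx]
    exact dualCode_mem i
  · rw [← hF.eq_iff, hF.map_mul, hF.map_mul, hx, hx, hx, hw]
    decide +kernel

theorem reflectionLength_eq_three (hF : IsH3Coding cs F) (hw : F w = quasiCode) :
    reflectionLength cs w = 3 := by
  obtain ⟨a, b, c, hr, -, habc⟩ := hF.exists_factorization hw
  have h1 := reflectionLength_mul_le cs (a * c) b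
  have h2 := reflectionLength_mul_le cs a c
  have ha := (reflectionLength_eq_one cs).2 (hr 0)
  have hb := (reflectionLength_eq_one cs).2 (hr 1)
  have hc := (reflectionLength_eq_one cs).2 (hr 2)
  simp only [Matrix.cons_val] at ha hb hc
  have hodd : ¬ Even (reflectionLength cs w) := by
    rw [← hF.digit_eq_iff_even, hw]
    decide
  have hne : reflectionLength cs w ≠ 1 := by
    rw [Ne, reflectionLength_eq_one, hF.refl, hw]
    decide
  rw [habc] at h1
  rw [Nat.not_even_iff_odd] at hodd
  obtain ⟨k, hk⟩ := hodd
  omega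

theorem isReflection_absLE (hF : IsH3Coding cs F) (hw : F w = quasiCode) {t : W}
    (ht : cs.IsReflection t) : AbsLE cs t w := by
  have hlen := hF.reflectionLength_eq_three hw
  have h1 := (reflectionLength_eq_one cs).2 ht
  have hev : Even (reflectionLength cs (t⁻¹ * w)) := by
    rw [← hF.digit_eq_iff_even, hF.map_mul, digit_codeMul_reflectionCode _
      ((hF.refl _).1 ht.isReflection_inv) _ (hF.mem w), hF.digit_eq_iff_even, hlen]
    decide
  have hne : t⁻¹ * w ≠ 1 := by
    rw [Ne, inv_mul_eq_one]
    rintro rfl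
    omega
  rw [AbsLE, hlen, h1, hF.reflectionLength_eq_two hev hne]

theorem intervalIsLattice (hF : IsH3Coding cs F) (hw : F w = quasiCode) :
    IntervalIsLattice cs w := by
  have hlen := hF.reflectionLength_eq_three hw
  refine intervalIsLattice_of_exists_meet cs fun x y hx hy =>
    exists_meet_of_length_eq_three cs hlen ?_ hx hy
  intro t t' r r' ht ht' htt' hr hr' hrw hrw' htr htr' htr2 htr2'
  -- An element `r` of length two below `w` has the form `u * w` with a reflection `u`.
  have hu {r : W} (hr : reflectionLength cs r = 2) (hrw : AbsLE cs r w) :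
      cs.IsReflection (r * w⁻¹) := by
    have h := (hrw.mul_inv cs)
    rw [AbsLE, show (w * r⁻¹)⁻¹ * w = r by group, hlen, hr] at h
    have h1 : cs.IsReflection (w * r⁻¹) := by
      rw [← reflectionLength_eq_one]
      omega
    simpa using h1.isReflection_inv
  have hmem {t r : W} (ht : cs.IsReflection t) (hr : reflectionLength cs r = 2)
      (htr : AbsLE cs t r) :
      codeMul (codeMul (F t) (F (r * w⁻¹))) quasiCode ∈ reflectionCodes := by
    rw [← hw, ← hF.map_mul, ← hF.map_mul, show t * (r * w⁻¹) * w = t * r by group, ← hF.refl,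
      ← reflectionLength_eq_one]
    rw [AbsLE, hr, (reflectionLength_eq_one cs).2 ht, ht.inv] at htr
    omega
  have key := eq_of_common_upper_bounds _ ((hF.refl t).1 ht) _ ((hF.refl t').1 ht')
    (fun e => htt' (hF.inj e)) _ ((hF.refl _).1 (hu hr hrw)) (hmem ht hr htr) (hmem ht' hr htr')
    _ ((hF.refl _).1 (hu hr' hrw')) (hmem ht hr' htr2) (hmem ht' hr' htr2')
  exact mul_right_cancel (hF.inj key)

theorem nonempty_mulEquiv (hF : IsH3Coding cs F) (hw : F w = quasiCode) :
    Nonempty (IntervalGroup cs w ≃* ArtinGroup CoxeterMatrix.H₃) := by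
  obtain ⟨a, b, c, hr, hcode, habc⟩ := hF.exists_factorization hw
  have ha := hcode 0
  have hb := hcode 1
  have hc := hcode 2
  simp only [Matrix.cons_val] at ha hb hc
  have htriple : IsH3Triple a b c := by
    constructor <;> simp only [← hF.eq_iff, hF.map_mul, ha, hb, hc] <;> decide +kernel
  have hdual (i : Fin 3) (k : ℕ) (hk : k < 5) : F (dualGen a b c i k) = dualCode i k := by
    induction k with
    | zero =>
      rw [← hcode i]
      simp [dualGen]
    | succ k ih =>
      have e := dualCode_succ i k (by omega)
      obtain ⟨y, hy⟩ := hF.surj _ (dualCode_mem_h3Codes i (k + 1) hk)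
      rw [← ih (by omega), ← hy, ← hw, ← hF.map_mul, ← hF.map_mul, hF.eq_iff] at e
      rw [dualGen_add i 1 k, pow_one, habc, ← hy, eq_mul_inv_of_mul_eq e]
  refine nonempty_intervalGroup_mulEquiv_artinGroup cs htriple (hr 0) (hr 1) (hr 2) habc
    (hF.reflectionLength_eq_three hw) (fun t ht => hF.isReflection_absLE hw ht) ?_ ?_ ?_
  · intro t ht
    obtain ⟨i, k, hk, e⟩ := exists_dualCode_eq _ ((hF.refl t).1 ht)
    exact ⟨i, k, hk, hF.inj (by rw [hdual i k hk, e])⟩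
  · intro i k hk j l hl e
    rw [← hF.eq_iff, hdual i k hk, hdual j l hl] at e
    exact dualCode_injective i k hk j l hl e
  · intro i j l hl m n hn e
    rw [← hF.eq_iff, hF.map_mul, hF.map_mul, hdual i 0 (by norm_num), hdual j l hl,
      hdual m n hn, hw] at e
    exact dualCode_mul_mem i j l hl m n hn e

/-- The reflections of the chosen factorization `a c b` generate the group: `c` is a simple
reflection, and the other two simple reflections are conjugates of `b`. -/
theorem isTypeH3a1 (hF : IsH3Coding cs F) (hword : ∀ l, F (cs.wordProd l) = wordCode l)
    (hw : F w = quasiCode) : IsTypeH3a1 cs w := by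
  obtain ⟨a, b, c, hr, hcode, habc⟩ := hF.exists_factorization hw
  have ha := hcode 0
  have hb := hcode 1
  have hc := hcode 2
  simp only [Matrix.cons_val] at ha hb hc
  refine ⟨⟨⟨[a, c, b], ⟨?_, ?_⟩, ?_, ?_⟩, ?_⟩, ?_⟩
  · intro t ht
    simp only [List.mem_cons, List.not_mem_nil, or_false] at ht
    rcases ht with rfl | rfl | rfl
    exacts [hr 0, hr 2, hr 1]
  · simpa [mul_assoc] using habc
  · rw [hF.reflectionLength_eq_three hw]
    rfl
  · set H := Subgroup.closure {t | t ∈ [a, c, b]} with hH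
    have haH : a ∈ H := Subgroup.subset_closure (by simp)
    have hbH : b ∈ H := Subgroup.subset_closure (by simp)
    have hcH : c ∈ H := Subgroup.subset_closure (by simp)
    rw [eq_top_iff, ← cs.subgroup_closure_range_simple, Subgroup.closure_le]
    have hs (i : Fin 3) : F (cs.simple i) = simpleCode i := by
      rw [← cs.wordProd_singleton, hword]
      revert i
      decide +kernel
    have h0 : cs.simple 0 = a * b * a * c * b * a * c * b * a := by
      simp only [← hF.eq_iff, hF.map_mul, ha, hb, hc, hs]
      decide +kernel
    have h1 : cs.simple 1 = c := by
      simp only [← hF.eq_iff, hc, hs]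
      decide +kernel
    have h2 : cs.simple 2 = b * c * b * c * b := by
      simp only [← hF.eq_iff, hF.map_mul, hb, hc, hs]
      decide +kernel
    rintro _ ⟨i, rfl⟩
    fin_cases i
    · change cs.simple 0 ∈ H
      rw [h0]
      repeat' first | apply mul_mem | assumption
    · change cs.simple 1 ∈ H
      rwa [h1]
    · change cs.simple 2 ∈ H
      rw [h2]
      repeat' first | apply mul_mem | assumption
  · rintro ⟨l, hl, hmem, hconj⟩
    obtain ⟨g, hg⟩ := isConj_iff.1 hconj
    have hperm : l.Perm [0, 1, 2] := by
      rw [List.perm_ext_iff_of_nodup hl (by decide)]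
      intro i
      simp only [hmem, true_iff]
      revert i
      decide
    obtain ⟨i, j, k, rfl⟩ := List.length_eq_three.1 hperm.length_eq
    refine coxeterCode_not_conj i j k hl (F g) (hF.mem g) ?_
    rw [← hword, ← hw, ← hF.map_mul, ← hF.map_mul, hF.eq_iff, ← hg, inv_mul_cancel_right]
  · have : orderOf w = 10 := by
      refine orderOf_eq_of_pow_and_pow_div_prime (by norm_num) ?_ ?_
      · rw [hF.pow_eq_one_iff, hw]
        decide +kernel
      · intro p hp hp10
        have : p = 2 ∨ p = 5 := by
          have h10 : p ∣ 2 * 5 := hp10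
          rcases (Nat.Prime.dvd_mul hp).1 h10 with h | h
          · exact Or.inl ((Nat.prime_dvd_prime_iff_eq hp Nat.prime_two).1 h)
          · exact Or.inr ((Nat.prime_dvd_prime_iff_eq hp Nat.prime_five).1 h)
        rcases this with rfl | rfl
        · rw [Ne, hF.pow_eq_one_iff, hw]
          decide +kernel
        · rw [Ne, hF.pow_eq_one_iff, hw]
          decide +kernel
    exact this

/-- Since the elements of order `10` form two classes, one of which consists of Coxeter elements,
the proper quasi-Coxeter elements of order `10` are conjugate. -/
theorem exists_conj_of_isTypeH3a1 (hF : IsH3Coding cs F)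
    (hword : ∀ l, F (cs.wordProd l) = wordCode l) {w₀ : W} (hw₀ : F w₀ = quasiCode)
    (hw : IsTypeH3a1 cs w) : IsConj w₀ w := by
  obtain ⟨⟨-, hcox⟩, hord⟩ := hw
  have h10 : w ^ 10 = 1 := hord ▸ pow_orderOf_eq_one w
  have h5 : w ^ 5 ≠ 1 := pow_ne_one_of_lt_orderOf (by norm_num) (by omega)
  have h2 : w ^ 2 ≠ 1 := pow_ne_one_of_lt_orderOf (by norm_num) (by omega)
  rw [Ne, hF.pow_eq_one_iff] at h5 h2
  rw [hF.pow_eq_one_iff] at h10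
  obtain ⟨g, hg, e⟩ := conj_of_order_ten _ (hF.mem w) h10 h5 h2
  obtain ⟨g, rfl⟩ := hF.surj g hg
  rw [← hw₀, ← hword, ← hF.map_mul, ← hF.map_mul, ← hF.map_mul, hF.eq_iff, hF.eq_iff] at e
  rcases e with e | e
  · exact isConj_iff.2 ⟨g, mul_inv_eq_of_eq_mul e⟩
  · exact absurd ⟨[0, 2, 1], by decide, by decide, isConj_iff.2 ⟨g, mul_inv_eq_of_eq_mul e⟩⟩ hcox

end IsH3Coding

theorem IsTypeH3a1.of_isConj {v w : W} (hv : IsTypeH3a1 cs v) (h : IsConj v w) :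
    IsTypeH3a1 cs w := by
  obtain ⟨⟨⟨l, hl, hlen, hgen⟩, hcox⟩, hord⟩ := hv
  obtain ⟨g, rfl⟩ := isConj_iff.1 h
  refine ⟨⟨⟨l.map (MulAut.conj g), hl.conj cs g, ?_, ?_⟩, ?_⟩, ?_⟩
  · rw [List.length_map, hlen, reflectionLength_conj]
  · have := congrArg (Subgroup.map (MulAut.conj g).toMonoidHom) hgen
    rw [MonoidHom.map_closure, Subgroup.map_top_of_surjective _ (MulAut.conj g).surjective] at this
    rw [← this]
    congr 1
    ext t
    simp
  · rintro ⟨l, hl, hmem, hconj⟩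
    exact hcox ⟨l, hl, hmem, hconj.trans h.symm⟩
  · rw [← hord]
    exact orderOf_injective (MulAut.conj g).toMonoidHom (MulAut.conj g).injective v

end QuasiCoxeter

end DualCoxeter

theorem mainTheorem6 {W : Type*} [Group W] (cs : CoxeterSystem CoxeterMatrix.H₃ W) :
    (∃ w₀ : W, ∀ w : W, DualCoxeter.IsTypeH3a1 cs w ↔ IsConj w₀ w) ∧
    ∀ w : W, DualCoxeter.IsTypeH3a1 cs w →
      Nonempty (DualCoxeter.IntervalGroup cs w ≃* DualCoxeter.ArtinGroup CoxeterMatrix.H₃) ∧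
      DualCoxeter.IntervalIsLattice cs w ∧
      DualCoxeter.IsGarsideGroup (DualCoxeter.IntervalGroup cs w) := by
  obtain ⟨F, hF, hword⟩ := DualCoxeter.exists_isH3Coding cs
  obtain ⟨w₀, hw₀⟩ := hF.surj DualCoxeter.quasiCode (by decide +kernel)
  have hclass (w : W) : DualCoxeter.IsTypeH3a1 cs w ↔ IsConj w₀ w := by
    refine ⟨hF.exists_conj_of_isTypeH3a1 hword hw₀, fun h => ?_⟩
    exact (hF.isTypeH3a1 hword hw₀).of_isConj h
  refine ⟨⟨w₀, hclass⟩, fun w hw => ?_⟩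
  -- After composition with an inner automorphism, the code of `w` is the chosen one.
  obtain ⟨g, hg⟩ := isConj_iff.1 ((hclass w).1 hw).symm
  have hF' := hF.conj g
  have hw' : F (g * w * g⁻¹) = DualCoxeter.quasiCode := by rw [hg, hw₀]
  have hfin : Finite (DualCoxeter.Interval cs w) := by
    have : Finite W := Finite.of_injective
      (fun x => (⟨F x, hF.mem x⟩ : {n // n ∈ DualCoxeter.h3Codes}))
      fun x y h => hF.inj (congrArg Subtype.val h)
    exact inferInstanceAs (Finite {x // DualCoxeter.AbsLE cs x w})
  have hL := hF'.intervalIsLattice hw'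
  exact ⟨hF'.nonempty_mulEquiv hw', hL, DualCoxeter.isGarsideGroup_of_intervalIsLattice cs hL⟩
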